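/- Let $n\ge 2$ and let $K\subset\mathbb R^n$ be a convex body (compact, convex, with nonempty interior). For $\delta>0$ let $$K_\delta=\bigcap_{|K\cap H^-|\le\delta}H^+$$ be its convex floating body: the intersection of all closed half-spaces $H^+$ whose complementary closed half-space $H^-$ (with the same bounding hyperplane) cuts off from $K$ a set of volume at most $\delta$. Call $K$ homothetic to $K_\delta$ if $K_\delta=cK$ for some $c>0$ (the center of homothety is the origin, for example the center of gravity of $K$). A vector $u$ is an outer unit normal of $K$ at $x\in\partial K$ if $\|u\|=1$ and $\langle u,y\rangle\le\langle u,x\rangle$ for all $y\in K$. $K$ is of class $C^1$ if every $x\in\partial K$ has exactly one outer unit normal. For $v\perp u$ put $f(v)=\inf\{t\ge 0: x+v-tu\in K\}\in[0,\infty]$. Numbers $k_1,\dots,k_{n-1}\in[0,\infty]$ are principal curvatures of $\partial K$ at $x$ with respect to $u$ if, for some orthonormal basis $e_1,\dots,e_{n-1}$ of $u^\perp$, $$\lim_{s\downarrow0}\frac{2f(sv)}{s^2}=\sum_{i=1}^{n-1}k_i\langle e_i,v\rangle^2\quad\text{for all }v\perp u\qquad(\infty\cdot0=0).$$ The Gauss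 curvature at $x$ is $\prod_i k_i\in[0,\infty]$, for any outer unit normal $u$ at $x$ for which such $k_i$ exist; it is not defined by $u$ if both $0$ and $\infty$ occur among the $k_i$. For an outer unit normal $u$ at $x\in\partial K$ let $\rho(x,u)$ be the radius of the largest Euclidean ball that is contained in $K$ and whose center lies on the line $\{x+tu:t\in\mathbb R\}$. Call a pair of real numbers $\rho_0,R>0$ admissible for $K$ if for every $x\in\partial K$ and every outer unit normal $u$ at $x$ $$\rho_0\le\rho(x,u)\qquad\text{and}\qquad K\subset B_2^n(x-Ru,R),$$ and put $$\delta_0(\rho_0,R)=\frac{\rho_0^{\,n-1}R\,|B_2^{n-1}|}{n\,2^{n-1}}\left(1-\Big(1-\big(\tfrac{\rho_0}{4R}\big)^2\Big)^{1/2}\right)^n .$$ Suppose that $K$ has a boundary point at which the Gauss curvature is $0$ or $\infty$. Then: 1. There is $\delta_1>0$ such that $K$ is not homothetic to $K_\delta$ for any $0<\delta\le\delta_1$. 2. For every admissible pair $(\rho_0,R)$, $K$ is not homothetic to $K_\delta$ for any $0<\delta\le\delta_0(\rho_0,R)$. 3. If $K$ is of class $C^1$ and $K$ is homothetic to $K_\delta$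 for some $\delta>0$, then an admissible pair $(\rho_0,R)$ exists. -/

import Mathlib

open MeasureTheory Filter Topology
open scoped Pointwise ENNReal

noncomputable section

/-- The Euclidean space `ℝⁿ`. -/
abbrev Eucl (n : ℕ) : Type := EuclideanSpace ℝ (Fin n)

/-- The convex floating body `K_δ`: the intersection of all half-spaces
`H⁺ = {y | ⟨u, y⟩ ≤ t}`, `‖u‖ = 1`, whose complementary closed half-space
`H⁻ = {y | t ≤ ⟨u, y⟩}` cuts off from `K` a set of volume at most `δ`. -/
def floatingBody {n : ℕ} (K : Set (Eucl n)) (δ : ℝ) : Set (Eucl n) :=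
  ⋂ (u : Eucl n) (t : ℝ)
    (_ : ‖u‖ = 1 ∧ volume (K ∩ {y | t ≤ inner ℝ u y}) ≤ ENNReal.ofReal δ),
    {y | inner ℝ u y ≤ t}

/-- `L` is homothetic to `K`, with the origin as center of homothety. -/
def HomotheticAtZero {n : ℕ} (K L : Set (Eucl n)) : Prop :=
  ∃ c : ℝ, 0 < c ∧ L = c • K

/-- `u` is an outer unit normal of `K` at `x`. If it is unique, it is `N_K(x)`. -/
def IsOuterUnitNormal {n : ℕ} (K : Set (Eucl n)) (x u : Eucl n) : Prop :=
  ‖u‖ = 1 ∧ ∀ y ∈ K, inner ℝ u y ≤ inner ℝ u x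

/-- The convex body `K` is of class `C¹`: through each boundary point passes exactly one
supporting hyperplane. -/
def IsClassC1 {n : ℕ} (K : Set (Eucl n)) : Prop :=
  ∀ x ∈ frontier K, ∃! u : Eucl n, IsOuterUnitNormal K x u

/-- The function whose graph over the supporting hyperplane `x + u^⊥` is the boundary of `K`
near `x`: the distance from `x + v` to `K` in the direction `-u` (`∞` if `K` is not met). -/
def boundaryHeight {n : ℕ} (K : Set (Eucl n)) (x u v : Eucl n) : ℝ≥0∞ :=
  ⨅ (t : ℝ) (_ : 0 ≤ t ∧ x + v - t • u ∈ K), ENNReal.ofReal t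

/-- `e` is an orthonormal basis of `u^⊥` and `k i ∈ [0, ∞]` are the (generalized) principal
curvatures of `∂K` at `x` in the directions `e i`: if `f` is the boundary function over the
supporting hyperplane `x + u^⊥`, then for each `v ⟂ u` the limit of `2 f(s v) / s²` as `s ↓ 0`
is `∑ k i ⟨e i, v⟩²` (with `∞ · 0 = 0`). If all `k i` are finite this says, `f` being
convex, that `f(v) = (1/2) ∑ k i ⟨e i, v⟩² + o(‖v‖²)`. -/
def HasPrincipalCurvatures {n : ℕ} (K : Set (Eucl n)) (x u : Eucl n)
    (e : Fin (n - 1) → Eucl n) (k : Fin (n - 1) → ℝ≥0∞) : Prop :=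
  IsOuterUnitNormal K x u ∧ Orthonormal ℝ e ∧ (∀ i, inner ℝ u (e i) = 0) ∧
    ∀ v : Eucl n, inner ℝ u v = 0 →
      Tendsto (fun s : ℝ => 2 * boundaryHeight K x u (s • v) / ENNReal.ofReal (s ^ 2))
        (𝓝[>] 0) (𝓝 (∑ i, k i * ENNReal.ofReal ((inner ℝ (e i) v) ^ 2)))

/-- The Gauss curvature of `∂K` at `x` is `κ ∈ [0, ∞]`: it is the product of the principal
curvatures. An indeterminate product `0 · ∞` is not given a value. -/
def HasGaussCurvature {n : ℕ} (K : Set (Eucl n)) (x : Eucl n) (κ : ℝ≥0∞) : Prop :=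
  ∃ (u : Eucl n) (e : Fin (n - 1) → Eucl n) (k : Fin (n - 1) → ℝ≥0∞),
    HasPrincipalCurvatures K x u e k ∧ ¬ ((∃ i, k i = 0) ∧ ∃ i, k i = ∞) ∧ κ = ∏ i, k i

/-- `ρ(x)`: the radius of the largest Euclidean ball contained in `K` whose center lies on the
line through `x` with direction `u`. -/
def normalLineInradius {n : ℕ} (K : Set (Eucl n)) (x u : Eucl n) : ℝ :=
  sSup {r : ℝ | 0 ≤ r ∧ ∃ t : ℝ, Metric.closedBall (x + t • u) r ⊆ K}

/-- The conditions on the constants `ρ₀` and `R`: for each boundary point `x` and each outer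
unit normal `u` at `x`, `0 < ρ₀ ≤ ρ(x)` and `K ⊆ B(x - R u, R)`. -/
def AdmissibleRadii {n : ℕ} (K : Set (Eucl n)) (ρ₀ R : ℝ) : Prop :=
  0 < ρ₀ ∧ 0 < R ∧ ∀ x ∈ frontier K, ∀ u : Eucl n, IsOuterUnitNormal K x u →
    ρ₀ ≤ normalLineInradius K x u ∧ K ⊆ Metric.closedBall (x - R • u) R

/-- The constant `δ₀`. -/
def deltaZero (n : ℕ) (ρ₀ R : ℝ) : ℝ :=
  ρ₀ ^ (n - 1) * R * volume.real (Metric.closedBall (0 : Eucl (n - 1)) 1) / (n * 2 ^ (n - 1)) *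
    (1 - √(1 - (ρ₀ / (4 * R)) ^ 2)) ^ n

end

/-!
For small `δ`, homothety transfers to `K` the regularity of its floating body: at each boundary
point `K` is touched by a ball from inside and by a ball from outside, so that its principal
curvatures lie in `(0, ∞)`.

Let `K_δ = c K` and `x ∈ ∂K`. Then `c < 1`, the origin is interior to `K`, and so `K` contains a
ball of uniform radius around `c x ∈ ∂K_δ` (`exists_isHomotheticBody`, `exists_closedBall_subset`).
Some hyperplane through `c x` cuts off exactly the volume `δ`; let `u` be its normal. The caps
through `c x` in all other directions have volume at least `δ`, because `c x ∈ K_δ`. Everything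
follows from the second difference of the volume `V` of caps through `c x`,
`V (u + θ w) + V (u - θ w) - 2 V u`, for unit vectors `w ⟂ u`. It is the volume of the wedges
between the hyperplane and its tilts below the hyperplane, minus the volume of those above it.

* *Upper bound.* A shear followed by a contraction by `1 - O(θ)` towards `c x` maps the lower wedges
  into the upper ones, so the second difference is at most `C θ²` (`capVol_second_difference_le`).
  Hence `V (u + θ w) ≤ δ + C θ²`, which bounds the support function of `K_δ` and puts `K_δ` into a
  ball that touches it at `c x` (`exists_norm_sq_le_of_capVol_eq`). A midpoint argument extends this
  to all outer normals (`norm_sq_le_of_forall_frontier`). So principal curvatures do not vanish. The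
  radius of this ball is the `R` of an admissible pair, for every `δ`; if `K` is of class `C¹`, the
  normal lines meet the interior and compactness of the set of normal pairs gives `ρ₀`.
* *Lower bound.* Let `(ρ₀, R)` be admissible. The constant `δ₀` is smaller than the volume of a cone
  in `K`, which shows that caps of volume `δ ≤ δ₀` are low (`height_le_of_capVol_le_deltaZero`).
  They lie above a ball in `K`, so `K` narrows across the cap (`exists_hasCapCones`). A shear
  combined with an expansion by `1 + κ θ` then maps the upper wedges into the lower ones, and the
  second difference is at least `a θ²`. Thus `u` is the only direction with `V = δ` (otherwise `V`
  would have a maximum between two such directions), `V` grows quadratically away from `u`, and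
  `K_δ` contains a ball that touches it at `c x` (`exists_closedBall_subset_floatingBody`). So
  principal curvatures are finite.

It remains to see that `K` is of class `C¹` when it is homothetic to `K_δ` for arbitrarily small `δ`
(`exists_lt_delta_of_not_isClassC1`). The largest ball in `K` around the origin touches `∂K`, which
gives `δ ≥ a (1 - c) ^ ((n + 1) / 2)`, while a point with two outer normals gives
`δ ≤ a' (1 - c) ^ ((n + 2) / 2)`. Both together bound `1 - c`, and hence `δ`, from below.
-/

/-! ### Volumes of boxes, slabs and wedges -/

/-- Two orthonormal vectors are the first two vectors of an orthonormal basis. -/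
theorem exists_orthonormalBasis_pair {m : ℕ} {u w : Eucl (m + 2)} (hu : ‖u‖ = 1) (hw : ‖w‖ = 1)
    (huw : inner ℝ u w = 0) :
    ∃ b : OrthonormalBasis (Fin (m + 2)) ℝ (Eucl (m + 2)), b 0 = u ∧ b 1 = w := by
  classical
  let v : Fin (m + 2) → Eucl (m + 2) := fun i => if i = 0 then u else w
  have hv : Orthonormal ℝ (({0, 1} : Set (Fin (m + 2))).domRestrict v) := by
    rw [orthonormal_iff_ite]
    rintro ⟨i, hi⟩ ⟨j, hj⟩
    have huw' : inner ℝ w u = 0 := by rw [real_inner_comm]; exact huw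
    rcases hi with rfl | rfl <;> rcases hj with rfl | rfl <;>
      simp [v, Set.domRestrict, hu, hw, huw, huw'] <;> exact fun h => by cases h
  obtain ⟨b, hb⟩ := hv.exists_orthonormalBasis_extension_of_card_eq (by simp)
  refine ⟨b, ?_, ?_⟩
  · simpa [v] using hb 0 (by simp)
  · simpa [v] using hb 1 (by simp)

theorem exists_unit_orthogonal {m : ℕ} {u : Eucl (m + 2)} (hu : ‖u‖ = 1) :
    ∃ w : Eucl (m + 2), ‖w‖ = 1 ∧ inner ℝ u w = 0 := by
  classical
  let v : Fin (m + 2) → Eucl (m + 2) := fun _ => u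
  have hv : Orthonormal ℝ (({0} : Set (Fin (m + 2))).domRestrict v) := by
    rw [orthonormal_iff_ite]
    rintro ⟨i, hi⟩ ⟨j, hj⟩
    rcases hi with rfl; rcases hj with rfl
    simp [v, Set.domRestrict, hu]
  obtain ⟨b, hb⟩ := hv.exists_orthonormalBasis_extension_of_card_eq (by simp)
  have h0 : b 0 = u := by simpa [v] using hb 0 (by simp)
  refine ⟨b 1, b.orthonormal.1 1, ?_⟩
  rw [← h0]; exact b.orthonormal.2 (by simp)

theorem OrthonormalBasis.volume_box {n : ℕ} (b : OrthonormalBasis (Fin n) ℝ (Eucl n)) (x : Eucl n)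
    (l m : Fin n → ℝ) :
    volume {y : Eucl n | ∀ i, inner ℝ (b i) (y - x) ∈ Set.Icc (l i) (m i)} =
      ∏ i, ENNReal.ofReal (m i - l i) := by
  have h1 : {y : Eucl n | ∀ i, inner ℝ (b i) (y - x) ∈ Set.Icc (l i) (m i)} =
      (fun y => y - x) ⁻¹' (b.repr ⁻¹' (WithLp.ofLp ⁻¹' (Set.Icc l m))) := by
    ext y
    simp only [Set.mem_ofPred_eq, Set.mem_preimage, Set.mem_Icc, Pi.le_def,
      ← OrthonormalBasis.repr_apply_apply]
    exact forall_and
  have hm : MeasurableSet (WithLp.ofLp ⁻¹' (Set.Icc l m) : Set (Eucl n)) :=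
    (PiLp.volume_preserving_ofLp (Fin n)).measurable measurableSet_Icc
  simp only [sub_eq_add_neg] at h1 ⊢
  rw [h1, measure_preimage_add_right,
    b.measurePreserving_repr.measure_preimage hm.nullMeasurableSet,
    (PiLp.volume_preserving_ofLp (Fin n)).measure_preimage measurableSet_Icc.nullMeasurableSet,
    Real.volume_Icc_pi]
  simp only [sub_eq_add_neg]

/-- The volume of a set that lies in a box, two of whose edges have the directions `u` and `w`. All
other edges have length `2 q`. -/
theorem volume_le_of_frame {m : ℕ} {u w x : Eucl (m + 2)} (hu : ‖u‖ = 1) (hw : ‖w‖ = 1)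
    (huw : inner ℝ u w = 0) {α β γ ε q : ℝ} (hαβ : α ≤ β) (hγε : γ ≤ ε) (hq : 0 ≤ q)
    {A : Set (Eucl (m + 2))}
    (hA : ∀ y ∈ A, inner ℝ u (y - x) ∈ Set.Icc α β ∧ inner ℝ w (y - x) ∈ Set.Icc γ ε ∧
      ‖y - x‖ ≤ q) :
    volume.real A ≤ (β - α) * (ε - γ) * (2 * q) ^ m := by
  obtain ⟨b, h0, h1⟩ := exists_orthonormalBasis_pair hu hw huw
  let l : Fin (m + 2) → ℝ := Fin.cons α (Fin.cons γ fun _ => -q)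
  let r : Fin (m + 2) → ℝ := Fin.cons β (Fin.cons ε fun _ => q)
  have hsub : A ⊆ {y | ∀ i, inner ℝ (b i) (y - x) ∈ Set.Icc (l i) (r i)} := by
    intro y hy i
    obtain ⟨ha, hb, hc⟩ := hA y hy
    refine Fin.cases ?_ (fun i => Fin.cases ?_ (fun j => ?_) i) i
    · simpa [l, r, h0] using ha
    · have : (Fin.succ 0 : Fin (m + 2)) = 1 := rfl
      rw [this, h1]; exact hb
    · have : |inner ℝ (b j.succ.succ) (y - x)| ≤ q := by
        refine (abs_real_inner_le_norm _ _).trans ?_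
        rw [b.orthonormal.1, one_mul]; exact hc
      simpa [l, r] using abs_le.1 this
  have hv := b.volume_box x l r
  have hle : volume A ≤ ENNReal.ofReal ((β - α) * (ε - γ) * (2 * q) ^ m) := by
    refine (measure_mono hsub).trans (le_of_eq ?_)
    rw [hv, Fin.prod_univ_succ, Fin.prod_univ_succ]
    simp only [l, r, Fin.cons_zero, Fin.cons_succ, Finset.prod_const, Finset.card_univ,
      Fintype.card_fin]
    rw [← ENNReal.ofReal_pow (by linarith), ← ENNReal.ofReal_mul (by linarith),
      ← ENNReal.ofReal_mul (by linarith)]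
    congr 1; ring
  exact ENNReal.toReal_le_of_le_ofReal (by
    have := sub_nonneg.2 hαβ; have := sub_nonneg.2 hγε; positivity) hle

/-- The volume of a set that contains a box, two of whose edges have the directions `u` and `w`. All
other edges have length `2 q`; only the norm bound that they imply enters the hypothesis. -/
theorem le_volume_of_frame {m : ℕ} {u w x : Eucl (m + 2)} (hu : ‖u‖ = 1) (hw : ‖w‖ = 1)
    (huw : inner ℝ u w = 0) {α β γ ε q : ℝ} (hαβ : α ≤ β) (hγε : γ ≤ ε) (hq : 0 ≤ q)
    {A : Set (Eucl (m + 2))} (hfin : volume A ≠ ∞)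
    (hA : ∀ y, inner ℝ u (y - x) ∈ Set.Icc α β → inner ℝ w (y - x) ∈ Set.Icc γ ε →
      ‖y - x‖ ^ 2 ≤ inner ℝ u (y - x) ^ 2 + inner ℝ w (y - x) ^ 2 + m * q ^ 2 → y ∈ A) :
    (β - α) * (ε - γ) * (2 * q) ^ m ≤ volume.real A := by
  obtain ⟨b, h0, h1⟩ := exists_orthonormalBasis_pair hu hw huw
  let l : Fin (m + 2) → ℝ := Fin.cons α (Fin.cons γ fun _ => -q)
  let r : Fin (m + 2) → ℝ := Fin.cons β (Fin.cons ε fun _ => q)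
  have h1' : b (Fin.succ 0) = w := h1
  have hsub : {y | ∀ i, inner ℝ (b i) (y - x) ∈ Set.Icc (l i) (r i)} ⊆ A := by
    intro y hy
    have hy0 := hy 0
    have hy1 := hy (Fin.succ 0)
    rw [h0] at hy0
    rw [h1'] at hy1
    refine hA y (by simpa [l, r] using hy0) (by simpa [l, r] using hy1) ?_
    rw [← b.sum_sq_inner_right (y - x), Fin.sum_univ_succ, Fin.sum_univ_succ, h0, h1', ← add_assoc]
    gcongr
    calc ∑ i : Fin m, inner ℝ (b i.succ.succ) (y - x) ^ 2 ≤ ∑ i : Fin m, q ^ 2 := by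
          refine Finset.sum_le_sum fun i _ => ?_
          have := hy i.succ.succ
          simp only [l, r, Fin.cons_succ] at this
          exact sq_le_sq' this.1 this.2
      _ = m * q ^ 2 := by simp
  have hv := b.volume_box x l r
  have hle : ENNReal.ofReal ((β - α) * (ε - γ) * (2 * q) ^ m) ≤ volume A := by
    refine le_trans (le_of_eq ?_) (measure_mono hsub)
    rw [hv, Fin.prod_univ_succ, Fin.prod_univ_succ]
    simp only [l, r, Fin.cons_zero, Fin.cons_succ, Finset.prod_const, Finset.card_univ,
      Fintype.card_fin]
    rw [← ENNReal.ofReal_pow (by linarith), ← ENNReal.ofReal_mul (by linarith),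
      ← ENNReal.ofReal_mul (by linarith)]
    congr 1; ring
  exact (ENNReal.ofReal_le_iff_le_toReal hfin).1 hle

theorem slab_volume_le {m : ℕ} {u x : Eucl (m + 2)} (hu : ‖u‖ = 1) {D s : ℝ} (hD : 0 ≤ D)
    (hs : 0 ≤ s) {A : Set (Eucl (m + 2))} (hA : A ⊆ Metric.closedBall x D)
    (hA' : ∀ y ∈ A, inner ℝ u (y - x) ∈ Set.Icc 0 s) :
    volume.real A ≤ (2 * D) ^ (m + 1) * s := by
  obtain ⟨w, hw, huw⟩ := exists_unit_orthogonal hu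
  refine (volume_le_of_frame (x := x) (q := D) hu hw huw hs (neg_le_self hD) hD fun y hy =>
    ⟨hA' y hy, ?_, ?_⟩).trans (le_of_eq (by ring))
  · refine abs_le.1 ((abs_real_inner_le_norm _ _).trans ?_)
    rw [hw, one_mul, ← dist_eq_norm]; exact hA hy
  · rw [← dist_eq_norm]; exact hA hy

theorem le_slab_volume {m : ℕ} {r : ℝ} (hr : 0 < r) :
    ∃ c > 0, ∀ u x : Eucl (m + 2), ‖u‖ = 1 → ∀ A : Set (Eucl (m + 2)), volume A ≠ ∞ →
      Metric.closedBall x r ⊆ A → ∀ s, 0 ≤ s → s ≤ r →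
        c * s ≤ volume.real (A ∩ {y | 0 ≤ inner ℝ u (y - x) ∧ inner ℝ u (y - x) < s}) := by
  set q := r / (m + 2) with hq
  have hq0 : 0 < q := by positivity
  have hqr : (m + 2) * q = r := by rw [hq]; field_simp
  refine ⟨(2 * q) ^ (m + 1) / (m + 3), by positivity, fun u x hu A hA hxA s hs hsr => ?_⟩
  obtain ⟨w, hw, huw⟩ := exists_unit_orthogonal hu
  rcases hs.eq_or_lt with rfl | hs0
  · simp [measureReal_nonneg]
  have hsq : s / (m + 3) ≤ q := by
    rw [div_le_iff₀ (by positivity)]; nlinarith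
  have hle := le_volume_of_frame (x := x) (α := 0) (β := s / (m + 3)) (γ := -q) (ε := q) (q := q)
    hu hw huw (by positivity) (by linarith) hq0.le
    (A := A ∩ {y | 0 ≤ inner ℝ u (y - x) ∧ inner ℝ u (y - x) < s})
    (ne_top_of_le_ne_top hA (measure_mono Set.inter_subset_left)) ?_
  · refine le_trans (le_of_eq ?_) hle
    field_simp; ring
  · rintro y ⟨hy1, hy2⟩ hy3 hy4
    refine ⟨hxA ?_, hy1, lt_of_le_of_lt hy2 ?_⟩
    · rw [Metric.mem_closedBall, dist_eq_norm]
      have h3 : inner ℝ w (y - x) ^ 2 ≤ q ^ 2 := sq_le_sq' hy3.1 hy3.2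
      have h2 : inner ℝ u (y - x) ^ 2 ≤ q ^ 2 := sq_le_sq' (by linarith) (by linarith)
      refine abs_le_of_sq_le_sq' ?_ hr.le |>.2
      have : (0:ℝ) ≤ m := by positivity
      nlinarith [mul_nonneg this (sq_nonneg q), mul_nonneg (mul_nonneg this this) (sq_nonneg q)]
    · rw [div_lt_iff₀ (by positivity)]; nlinarith [(Nat.cast_nonneg m : (0:ℝ) ≤ m)]

theorem le_wedge_volume {m : ℕ} {r : ℝ} (hr : 0 < r) :
    ∃ c > 0, ∀ u w x : Eucl (m + 2), ‖u‖ = 1 → ‖w‖ = 1 → inner ℝ u w = 0 →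
      ∀ A : Set (Eucl (m + 2)), volume A ≠ ∞ → Metric.closedBall x r ⊆ A →
        ∀ θ, 0 < θ → θ ≤ 1 → c * θ ≤ volume.real
          (A ∩ {y | 0 ≤ inner ℝ u (y - x) ∧ inner ℝ u (y - x) - θ * inner ℝ w (y - x) < 0}) := by
  set q := r / (m + 2) with hq
  have hq0 : 0 < q := by positivity
  have hqr : (m + 2) * q = r := by rw [hq]; field_simp
  refine ⟨(2 * q) ^ m * (q / 2) * (q / 4), by positivity,
    fun u w x hu hw huw A hA hxA θ hθ hθ1 => ?_⟩
  have hle := le_volume_of_frame (x := x) (α := 0) (β := θ * q / 4) (γ := q / 2) (ε := q) (q := q)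
    hu hw huw (by positivity) (by linarith) hq0.le
    (A := A ∩ {y | 0 ≤ inner ℝ u (y - x) ∧ inner ℝ u (y - x) - θ * inner ℝ w (y - x) < 0})
    (ne_top_of_le_ne_top hA (measure_mono Set.inter_subset_left)) ?_
  · refine le_trans (le_of_eq ?_) hle
    ring
  · rintro y ⟨hy1, hy2⟩ ⟨hy3, hy3'⟩ hy4
    have hθq : θ * q ≤ q := by nlinarith
    refine ⟨hxA ?_, hy1, ?_⟩
    · rw [Metric.mem_closedBall, dist_eq_norm]
      have h3 : inner ℝ w (y - x) ^ 2 ≤ q ^ 2 := sq_le_sq' (by linarith) hy3'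
      have h2 : inner ℝ u (y - x) ^ 2 ≤ q ^ 2 := sq_le_sq' (by linarith) (by linarith)
      refine abs_le_of_sq_le_sq' ?_ hr.le |>.2
      have : (0:ℝ) ≤ m := by positivity
      nlinarith [mul_nonneg this (sq_nonneg q), mul_nonneg (mul_nonneg this this) (sq_nonneg q)]
    · have := mul_le_mul_of_nonneg_left hy3 hθ.le
      have := mul_pos hθ hq0
      linarith

/-- Comparison of volumes by a linear map with fixed point `x` in place of the origin. -/
theorem abs_det_mul_volume_le {n : ℕ} (T : Eucl n →ₗ[ℝ] Eucl n) (x : Eucl n) {A B : Set (Eucl n)}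
    (hB : volume B ≠ ∞) (h : ∀ y ∈ A, x + T (y - x) ∈ B) :
    |LinearMap.det T| * volume.real A ≤ volume.real B := by
  have h1 : (fun z => x + z) '' (T '' ((fun y => y - x) '' A)) ⊆ B := by
    rintro _ ⟨_, ⟨_, ⟨y, hy, rfl⟩, rfl⟩, rfl⟩
    exact h y hy
  have h2 := measure_mono (μ := volume) h1
  rw [Set.image_add_left, measure_preimage_add, Measure.addHaar_image_linearMap] at h2
  have h3 : volume ((fun y => y - x) '' A) = volume A := by
    have : (fun y => y - x) '' A = (fun y => y + x) ⁻¹' A := by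
      ext z; simp [sub_eq_iff_eq_add]
    rw [this, measure_preimage_add_right]
  rw [h3] at h2
  have := ENNReal.toReal_mono hB h2
  rwa [ENNReal.toReal_mul, ENNReal.toReal_ofReal (abs_nonneg _)] at this

/-- The linear map `z ↦ z + ⟨w, z⟩ v`. -/
noncomputable def shear {n : ℕ} (w v : Eucl n) : Eucl n →ₗ[ℝ] Eucl n :=
  LinearMap.transvection (innerSL ℝ w).toLinearMap v

theorem shear_apply {n : ℕ} (w v z : Eucl n) : shear w v z = z + inner ℝ w z • v := by
  simp [shear, LinearMap.transvection.apply]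

theorem det_shear {n : ℕ} (w v : Eucl n) : LinearMap.det (shear w v) = 1 + inner ℝ w v := by
  simp [shear]

/-! ### Volumes of caps -/

/-- The volume of the cap that the half-space `{y | 0 ≤ ⟨u, y - x⟩}`, bounded by the hyperplane
through `x` with normal `u`, cuts off from `K`. The vector `u` need not be normalized. -/
noncomputable def capVol {n : ℕ} (K : Set (Eucl n)) (x u : Eucl n) : ℝ :=
  volume.real (K ∩ {y | 0 ≤ inner ℝ u (y - x)})

/-- The volume that the cap through `x` gains when its normal `u` is replaced by `u + v`. -/
noncomputable def gainVol {n : ℕ} (K : Set (Eucl n)) (x u v : Eucl n) : ℝ :=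
  volume.real (K ∩ {y | inner ℝ u (y - x) < 0 ∧ 0 ≤ inner ℝ u (y - x) + inner ℝ v (y - x)})

/-- The volume that the cap through `x` loses when its normal `u` is replaced by `u + v`. -/
noncomputable def lossVol {n : ℕ} (K : Set (Eucl n)) (x u v : Eucl n) : ℝ :=
  volume.real (K ∩ {y | 0 ≤ inner ℝ u (y - x) ∧ inner ℝ u (y - x) + inner ℝ v (y - x) < 0})

theorem capVol_smul {n : ℕ} (K : Set (Eucl n)) (x u : Eucl n) {c : ℝ} (hc : 0 < c) :
    capVol K x (c • u) = capVol K x u := by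
  unfold capVol
  congr 2
  ext y
  simp only [Set.mem_ofPred_eq, inner_smul_left, conj_trivial]
  rw [mul_nonneg_iff_of_pos_left hc]

theorem continuousAt_capVol {n : ℕ} {K : Set (Eucl n)} (hK : IsCompact K) (x : Eucl n) {u : Eucl n}
    (hu : u ≠ 0) : ContinuousAt (fun p : Eucl n × Eucl n => capVol K p.1 p.2) (x, u) := by
  have hmeas : ∀ p : Eucl n × Eucl n, MeasurableSet {y : Eucl n | 0 ≤ inner ℝ p.2 (y - p.1)} :=
    fun p => measurableSet_le measurable_const (by fun_prop)
  have heq : (fun p : Eucl n × Eucl n => capVol K p.1 p.2) = fun p => ∫ y in K,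
      ({y : Eucl n | 0 ≤ inner ℝ p.2 (y - p.1)}).indicator (fun _ => (1 : ℝ)) y := by
    ext p
    rw [integral_indicator_const _ (hmeas p), smul_eq_mul, mul_one,
      measureReal_restrict_apply (hmeas p), Set.inter_comm]
    rfl
  rw [heq]
  have : Fact (volume K < ∞) := ⟨hK.measure_lt_top⟩
  refine continuousAt_of_dominated (bound := fun _ => 1) ?_ ?_ (integrable_const _) ?_
  · exact Eventually.of_forall fun p =>
      (measurable_const.indicator (hmeas p)).aestronglyMeasurable
  · refine Eventually.of_forall fun p => Eventually.of_forall fun y => ?_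
    by_cases h : y ∈ {y : Eucl n | 0 ≤ inner ℝ p.2 (y - p.1)} <;> simp [Set.indicator, h]
  · have hnull : volume {y : Eucl n | inner ℝ u (y - x) = 0} = 0 := by
      let S : AffineSubspace ℝ (Eucl n) :=
        AffineSubspace.mk' x (LinearMap.ker (innerSL ℝ u).toLinearMap)
      have hS : (S : Set (Eucl n)) = {y : Eucl n | inner ℝ u (y - x) = 0} := by
        ext y
        simp [S, AffineSubspace.mem_mk']
      rw [← hS]
      refine Measure.addHaar_affineSubspace _ _ fun h => hu ?_
      have : x + u ∈ (S : Set (Eucl n)) := by rw [h]; trivial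
      rw [hS] at this
      simpa using this
    have hae : ∀ᵐ y ∂(volume : Measure (Eucl n)), inner ℝ u (y - x) ≠ 0 := by
      rw [ae_iff]; simpa using hnull
    filter_upwards [ae_restrict_of_ae hae] with y hy
    have hc : ContinuousAt (fun p : Eucl n × Eucl n => inner ℝ p.2 (y - p.1)) (x, u) := by fun_prop
    rcases lt_or_gt_of_ne hy with h | h
    · refine (continuousAt_const (y := (0 : ℝ))).congr ?_
      filter_upwards [hc.eventually (gt_mem_nhds h)] with p hp
      rw [Set.indicator_of_notMem]; simpa using hp
    · refine (continuousAt_const (y := (1 : ℝ))).congr ?_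
      filter_upwards [hc.eventually (lt_mem_nhds h)] with p hp
      rw [Set.indicator_of_mem]; exact le_of_lt hp

theorem capVol_add_lossVol {n : ℕ} {K : Set (Eucl n)} (hK : IsCompact K) (x u v : Eucl n) :
    capVol K x (u + v) + lossVol K x u v = capVol K x u + gainVol K x u v := by
  have hKm := hK.isClosed.measurableSet
  have m1 : MeasurableSet (K ∩ {y | 0 ≤ inner ℝ u (y - x) ∧
      inner ℝ u (y - x) + inner ℝ v (y - x) < 0}) :=
    hKm.inter (by
      rw [Set.ofPred_and]
      exact (measurableSet_le measurable_const (by fun_prop)).inter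
        (measurableSet_lt (by fun_prop) measurable_const))
  have m2 : MeasurableSet (K ∩ {y | inner ℝ u (y - x) < 0 ∧
      0 ≤ inner ℝ u (y - x) + inner ℝ v (y - x)}) :=
    hKm.inter (by
      rw [Set.ofPred_and]
      exact (measurableSet_lt (by fun_prop) measurable_const).inter
        (measurableSet_le measurable_const (by fun_prop)))
  have hf : ∀ s : Set (Eucl n), volume (K ∩ s) ≠ ∞ := fun s =>
    ne_top_of_le_ne_top hK.measure_lt_top.ne (measure_mono Set.inter_subset_left)
  unfold capVol gainVol lossVol
  rw [← measureReal_union _ m1 (hf _) (hf _), ← measureReal_union _ m2 (hf _) (hf _)]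
  · congr 1
    ext y
    simp only [inner_add_left, Set.mem_union, Set.mem_inter_iff, Set.mem_ofPred_eq]
    rw [← not_le, ← not_le]
    tauto
  · rw [Set.disjoint_left]
    rintro y ⟨_, h1⟩ ⟨_, h2, _⟩
    simp only [Set.mem_ofPred_eq] at h1; linarith
  · rw [Set.disjoint_left]
    rintro y ⟨_, h1⟩ ⟨_, _, h2⟩
    simp only [Set.mem_ofPred_eq, inner_add_left] at h1; linarith

/-- Cutting at the height `s` above `x` in the direction `u` removes a slab from the cap. -/
theorem capVol_eq_capVol_add_slab {n : ℕ} {K : Set (Eucl n)} (hK : IsCompact K) (x : Eucl n)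
    {u : Eucl n} (z : Eucl n) (hz : 0 ≤ inner ℝ u (z - x)) :
    capVol K x u = capVol K z u + volume.real
      (K ∩ {y | 0 ≤ inner ℝ u (y - x) ∧ inner ℝ u (y - x) < inner ℝ u (z - x)}) := by
  have m1 : MeasurableSet (K ∩ {y | 0 ≤ inner ℝ u (y - x) ∧
      inner ℝ u (y - x) < inner ℝ u (z - x)}) :=
    hK.isClosed.measurableSet.inter (by
      rw [Set.ofPred_and]
      exact (measurableSet_le measurable_const (by fun_prop)).inter
        (measurableSet_lt (by fun_prop) measurable_const))
  have hf : ∀ s : Set (Eucl n), volume (K ∩ s) ≠ ∞ := fun s =>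
    ne_top_of_le_ne_top hK.measure_lt_top.ne (measure_mono Set.inter_subset_left)
  unfold capVol
  have key : ∀ y, inner ℝ u (y - z) = inner ℝ u (y - x) - inner ℝ u (z - x) := fun y => by
    rw [← inner_sub_right]; congr 1; abel
  rw [← measureReal_union _ m1 (hf _) (hf _)]
  · congr 1
    ext y
    simp only [Set.mem_union, Set.mem_inter_iff, Set.mem_ofPred_eq, key]
    by_cases h1 : y ∈ K <;> simp only [h1, true_and, false_and, or_self]
    constructor
    · intro h
      rcases le_or_gt 0 (inner ℝ u (y - x) - inner ℝ u (z - x)) with h2 | h2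
      · exact Or.inl h2
      · exact Or.inr ⟨h, by linarith⟩
    · rintro (h | ⟨h, _⟩) <;> linarith
  · rw [Set.disjoint_left]
    rintro y ⟨_, h1⟩ ⟨_, _, h2⟩
    simp only [Set.mem_ofPred_eq, key] at h1; linarith

/-! ### The floating body in terms of caps -/

theorem volume_inter_halfSpace_le_iff {n : ℕ} {K : Set (Eucl n)} (hK : IsCompact K) {x u : Eucl n}
    {t δ : ℝ} (hδ : 0 ≤ δ) (ht : inner ℝ u x = t) :
    volume (K ∩ {y | t ≤ inner ℝ u y}) ≤ ENNReal.ofReal δ ↔ capVol K x u ≤ δ := by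
  have : {y | t ≤ inner ℝ u y} = {y | 0 ≤ inner ℝ u (y - x)} := by
    ext y; simp only [Set.mem_ofPred_eq, inner_sub_right, ht, sub_nonneg]
  rw [this, capVol, Measure.real]
  exact ENNReal.le_ofReal_iff_toReal_le (ne_top_of_le_ne_top hK.measure_lt_top.ne
    (measure_mono Set.inter_subset_left)) hδ

theorem inner_le_of_mem_floatingBody {n : ℕ} {K : Set (Eucl n)} (hK : IsCompact K) {δ : ℝ}
    (hδ : 0 ≤ δ) {x u y : Eucl n} (hu : ‖u‖ = 1) (hx : capVol K x u ≤ δ)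
    (hy : y ∈ floatingBody K δ) : inner ℝ u y ≤ inner ℝ u x := by
  simp only [floatingBody, Set.mem_iInter] at hy
  exact hy u _ ⟨hu, (volume_inter_halfSpace_le_iff hK hδ rfl).2 hx⟩

theorem exists_capVol_le_of_notMem_floatingBody {n : ℕ} {K : Set (Eucl n)} (hK : IsCompact K)
    {δ : ℝ} (hδ : 0 ≤ δ) {y : Eucl n} (hy : y ∉ floatingBody K δ) :
    ∃ u, ‖u‖ = 1 ∧ capVol K y u ≤ δ ∧ ∀ z ∈ floatingBody K δ, inner ℝ u z < inner ℝ u y := by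
  simp only [floatingBody, Set.mem_iInter, not_forall] at hy
  obtain ⟨u, t, ⟨hu, ht⟩, hyt⟩ := hy
  simp only [Set.mem_ofPred_eq, not_le] at hyt
  refine ⟨u, hu, ?_, fun z hz => ?_⟩
  · rw [← volume_inter_halfSpace_le_iff hK hδ rfl]
    refine (measure_mono (Set.inter_subset_inter_right _ fun z hz => ?_)).trans ht
    exact hyt.le.trans hz
  · simp only [floatingBody, Set.mem_iInter] at hz
    exact lt_of_le_of_lt (hz u t ⟨hu, ht⟩) hyt

theorem le_capVol_of_mem_floatingBody {n : ℕ} {K : Set (Eucl n)} (hK : IsCompact K) {δ : ℝ}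
    (hδ : 0 ≤ δ) {y u : Eucl n} (hu : u ≠ 0) (hy : y ∈ floatingBody K δ) : δ ≤ capVol K y u := by
  have hu' : 0 < ‖u‖ := norm_pos_iff.2 hu
  rw [← capVol_smul K y u (inv_pos.2 hu')]
  have hn : ‖‖u‖⁻¹ • u‖ = 1 := by rw [norm_smul, norm_inv, norm_norm, inv_mul_cancel₀ hu'.ne']
  generalize ‖u‖⁻¹ • u = v at hn
  by_contra! hlt
  have hv : v ≠ 0 := by rintro rfl; simp at hn
  have hc : ContinuousAt (fun ε : ℝ => capVol K (y - ε • v) v) 0 := by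
    have h1 : ContinuousAt (fun p : Eucl n × Eucl n => capVol K p.1 p.2)
        ((fun ε : ℝ => (y - ε • v, v)) 0) := by simpa using continuousAt_capVol hK y hv
    exact ContinuousAt.comp (f := fun ε : ℝ => (y - ε • v, v)) h1 (by fun_prop)
  have hev := hc.eventually (gt_mem_nhds (by simpa using hlt))
  obtain ⟨ε, hε, hε0⟩ := ((hev.filter_mono nhdsWithin_le_nhds).and
    (self_mem_nhdsWithin (s := Set.Ioi (0 : ℝ)))).exists
  have := inner_le_of_mem_floatingBody hK hδ hn (le_of_lt hε) hy
  rw [inner_sub_right, inner_smul_right, real_inner_self_eq_norm_sq, hn] at this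
  have : (0 : ℝ) < ε := hε0
  linarith

/-- Through each boundary point of the floating body passes a hyperplane that cuts off exactly the
volume `δ`. -/
theorem exists_capVol_eq_of_mem_frontier {n : ℕ} {K : Set (Eucl n)} (hK : IsCompact K) {δ : ℝ}
    (hδ : 0 ≤ δ) {x : Eucl n} (hx : x ∈ floatingBody K δ) (hx' : x ∉ interior (floatingBody K δ)) :
    ∃ u, ‖u‖ = 1 ∧ capVol K x u = δ := by
  by_contra! hne
  apply hx'
  have h0 : ∀ u ∈ Metric.sphere (0 : Eucl n) 1, u ≠ 0 := fun u hu => by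
    rintro rfl; simp at hu
  have hev : ∀ u ∈ Metric.sphere (0 : Eucl n) 1,
      ∀ᶠ p : Eucl n × Eucl n in 𝓝 (x, u), δ < capVol K p.1 p.2 := fun u hu =>
    (continuousAt_capVol hK x (h0 u hu)).eventually (lt_mem_nhds
      (lt_of_le_of_ne (le_capVol_of_mem_floatingBody hK hδ (h0 u hu) hx)
        (hne u (by simpa using hu)).symm))
  have : ∀ᶠ y in 𝓝 x, ∀ u ∈ Metric.sphere (0 : Eucl n) 1, δ < capVol K y u :=
    (isCompact_sphere (0 : Eucl n) 1).eventually_forall_of_forall_eventually hev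
  rw [mem_interior_iff_mem_nhds]
  filter_upwards [this] with y hy
  by_contra hyL
  obtain ⟨u, hu, hle, -⟩ := exists_capVol_le_of_notMem_floatingBody hK hδ hyL
  exact absurd (hy u (by simpa using hu)) (not_lt.2 hle)

/-! ### Bodies that are homothetic to a floating body -/

/-- `K` is a convex body with `K_δ = c K`, where `0 < c < 1` and the origin is interior to `K`.
The last two properties hold automatically, by `exists_isHomotheticBody`. -/
structure IsHomotheticBody {n : ℕ} (K : Set (Eucl n)) (δ c : ℝ) : Prop where
  isCompact : IsCompact K
  convex : Convex ℝ K
  zero_mem : (0 : Eucl n) ∈ interior K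
  delta_pos : 0 < δ
  c_pos : 0 < c
  c_lt_one : c < 1
  eq_smul : floatingBody K δ = c • K

/-- A line that misses the interior of a convex body lies in a hyperplane that does not cut the
body. For `u = 0` this is the separation of a point from the body. -/
theorem exists_unit_normal_of_line_disjoint {n : ℕ} {K : Set (Eucl n)} (hconv : Convex ℝ K)
    (hint : (interior K).Nonempty) {x u : Eucl n} (h : ∀ t : ℝ, x + t • u ∉ interior K) :
    ∃ v : Eucl n, ‖v‖ = 1 ∧ inner ℝ v u = 0 ∧ ∀ y ∈ K, inner ℝ v y ≤ inner ℝ v x := by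
  have hline : Convex ℝ (Set.range fun t : ℝ => x + t • u) := by
    rintro _ ⟨s, rfl⟩ _ ⟨t, rfl⟩ a b _ _ hab
    refine ⟨a * s + b * t, ?_⟩
    obtain rfl : b = 1 - a := by linarith
    simp only
    module
  have hdisj : Disjoint (interior K) (Set.range fun t : ℝ => x + t • u) := by
    rw [Set.disjoint_right]
    rintro _ ⟨t, rfl⟩
    exact h t
  obtain ⟨f, s, hf, hs⟩ := geometric_hahn_banach_open hconv.interior isOpen_interior hline hdisj
  set w := (InnerProductSpace.toDual ℝ (Eucl n)).symm f with hw
  have hfw : ∀ y, f y = inner ℝ w y := fun y => by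
    rw [hw, InnerProductSpace.toDual_symm_apply]
  have hsx : ∀ t : ℝ, s ≤ inner ℝ w x + t * inner ℝ w u := fun t => by
    have := hs _ ⟨t, rfl⟩
    rwa [hfw, inner_add_right, inner_smul_right] at this
  have hwu : inner ℝ w u = 0 := by
    by_contra h0
    have := hsx ((s - 1 - inner ℝ w x) / inner ℝ w u)
    rw [div_mul_cancel₀ _ h0] at this
    linarith
  obtain ⟨q, hq⟩ := hint
  have hle : ∀ y ∈ K, inner ℝ w y ≤ inner ℝ w x := by
    intro y hy
    have hy' : y ∈ closure (interior K) := by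
      rw [hconv.closure_interior_eq_closure_of_nonempty_interior ⟨q, hq⟩]
      exact subset_closure hy
    refine closure_minimal (s := interior K) (t := {y | inner ℝ w y ≤ inner ℝ w x})
      (fun z hz => ?_) (isClosed_le (by fun_prop) continuous_const) hy'
    have h1 := hf z hz
    have h2 := hsx 0
    rw [hfw] at h1
    simp only [Set.mem_ofPred_eq]
    linarith
  have hw0 : w ≠ 0 := by
    intro h0
    have h1 := hf q hq
    have h2 := hsx 0
    rw [hfw] at h1
    simp only [h0, inner_zero_left] at h1 h2
    linarith
  have hwn : 0 < ‖w‖ := norm_pos_iff.2 hw0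
  refine ⟨‖w‖⁻¹ • w, by rw [norm_smul, norm_inv, norm_norm, inv_mul_cancel₀ hwn.ne'], ?_,
    fun y hy => ?_⟩
  · rw [inner_smul_left, hwu, mul_zero]
  · rw [inner_smul_left, inner_smul_left]
    exact mul_le_mul_of_nonneg_left (hle y hy) (by simp)

theorem exists_isHomotheticBody {m : ℕ} {K : Set (Eucl (m + 2))} (hK : IsCompact K)
    (hconv : Convex ℝ K) (hint : (interior K).Nonempty) {δ : ℝ} (hδ : 0 < δ)
    (h : HomotheticAtZero K (floatingBody K δ)) : ∃ c, IsHomotheticBody K δ c := by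
  obtain ⟨c, hc, hL⟩ := h
  have hne : K.Nonempty := hint.mono interior_subset
  -- the support function of `c K` is strictly smaller than the one of `K`
  have key : ∀ u : Eucl (m + 2), ‖u‖ = 1 →
      ∃ p ∈ K, (∀ y ∈ K, inner ℝ u y ≤ inner ℝ u p) ∧ 0 < (1 - c) * inner ℝ u p := by
    intro u hu
    have hu0 : u ≠ 0 := by rintro rfl; simp at hu
    obtain ⟨p, hp, hmax⟩ := hK.exists_isMaxOn hne
      (f := fun y => inner ℝ u y) (by fun_prop)
    refine ⟨p, hp, fun y hy => hmax hy, ?_⟩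
    have hmax' : ∀ y ∈ K, inner ℝ u y ≤ inner ℝ u p := fun y hy => hmax hy
    obtain ⟨D, hD⟩ := hK.isBounded.subset_closedBall p
    have hD0 : 0 ≤ D := by simpa using hD hp
    have hV0 : capVol K p u = 0 := by
      refine le_antisymm ?_ measureReal_nonneg
      refine (slab_volume_le (x := p) hu hD0 le_rfl (fun y hy => hD hy.1) fun y hy => ?_).trans
        (by simp)
      have h1 := hmax' y hy.1
      have h2 : 0 ≤ inner ℝ u (y - p) := hy.2
      refine ⟨h2, ?_⟩
      rw [inner_sub_right]; linarith
    have hcont : ContinuousAt (fun ε : ℝ => capVol K (p - ε • u) u) 0 := by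
      have h1 : ContinuousAt (fun p : Eucl (m + 2) × Eucl (m + 2) => capVol K p.1 p.2)
          ((fun ε : ℝ => (p - ε • u, u)) 0) := by simpa using continuousAt_capVol hK p hu0
      exact ContinuousAt.comp (f := fun ε : ℝ => (p - ε • u, u)) h1 (by fun_prop)
    have hev : ∀ᶠ ε in 𝓝 (0 : ℝ), capVol K (p - ε • u) u < δ :=
      hcont.eventually (gt_mem_nhds (by simpa [hV0] using hδ))
    obtain ⟨ε, hε, hε0⟩ := ((hev.filter_mono nhdsWithin_le_nhds).and
      (self_mem_nhdsWithin (s := Set.Ioi (0 : ℝ)))).exists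
    have hcp : c • p ∈ floatingBody K δ := by rw [hL]; exact Set.smul_mem_smul_set hp
    have := inner_le_of_mem_floatingBody hK hδ.le hu (le_of_lt hε) hcp
    rw [inner_sub_right, inner_smul_right, inner_smul_right, real_inner_self_eq_norm_sq, hu] at this
    have : (0 : ℝ) < ε := hε0
    linarith
  have hc1 : c < 1 := by
    obtain ⟨u, hu⟩ := exists_norm_eq (Eucl (m + 2)) zero_le_one
    obtain ⟨p, hp, hpm, h1⟩ := key u hu
    obtain ⟨q, hq, hqm, h2⟩ := key (-u) (by simpa using hu)
    have h3 := hqm p hp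
    simp only [inner_neg_left] at h2 h3
    nlinarith
  refine ⟨c, hK, hconv, ?_, hδ, hc, hc1, hL⟩
  by_contra h0
  obtain ⟨w, hw, -, hle⟩ := exists_unit_normal_of_line_disjoint hconv hint (x := 0) (u := 0)
    (by simpa using h0)
  obtain ⟨p, hp, -, h1⟩ := key w hw
  have := hle p hp
  rw [inner_zero_right] at this
  nlinarith

namespace IsHomotheticBody

variable {n : ℕ} {K : Set (Eucl n)} {δ c : ℝ}

theorem smul_mem (h : IsHomotheticBody K δ c) {x : Eucl n} (hx : x ∈ K) :
    c • x ∈ floatingBody K δ := by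
  rw [h.eq_smul]; exact Set.smul_mem_smul_set hx

theorem le_capVol (h : IsHomotheticBody K δ c) {x u : Eucl n} (hx : x ∈ K) (hu : u ≠ 0) :
    δ ≤ capVol K (c • x) u :=
  le_capVol_of_mem_floatingBody h.isCompact h.delta_pos.le hu (h.smul_mem hx)

theorem exists_capVol_eq (h : IsHomotheticBody K δ c) {x : Eucl n} (hx : x ∈ frontier K) :
    ∃ u, ‖u‖ = 1 ∧ capVol K (c • x) u = δ := by
  have hxK : x ∈ K := h.isCompact.isClosed.frontier_subset hx
  refine exists_capVol_eq_of_mem_frontier h.isCompact h.delta_pos.le (h.smul_mem hxK) ?_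
  rw [h.eq_smul, interior_smul₀ h.c_pos.ne', Set.smul_mem_smul_set_iff₀ h.c_pos.ne']
  exact hx.2

theorem isOuterUnitNormal (h : IsHomotheticBody K δ c) {x u : Eucl n} (hu : ‖u‖ = 1)
    (hV : capVol K (c • x) u ≤ δ) : IsOuterUnitNormal K x u := by
  refine ⟨hu, fun y hy => ?_⟩
  have := inner_le_of_mem_floatingBody h.isCompact h.delta_pos.le hu hV (h.smul_mem hy)
  rw [inner_smul_right, inner_smul_right] at this
  exact le_of_mul_le_mul_left this h.c_pos

theorem exists_closedBall_subset (h : IsHomotheticBody K δ c) :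
    ∃ r > 0, ∀ x ∈ K, Metric.closedBall (c • x) r ⊆ K := by
  obtain ⟨r, hr, hrK⟩ := Metric.nhds_basis_closedBall.mem_iff.1
    (mem_interior_iff_mem_nhds.1 h.zero_mem)
  have hc : 0 < 1 - c := sub_pos.2 h.c_lt_one
  refine ⟨(1 - c) * r, mul_pos hc hr, fun x hx y hy => ?_⟩
  have hz : (1 - c)⁻¹ • (y - c • x) ∈ K := by
    refine hrK ?_
    rw [mem_closedBall_zero_iff, norm_smul, norm_inv, Real.norm_of_nonneg hc.le,
      inv_mul_le_iff₀ hc, ← dist_eq_norm]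
    exact hy
  have := h.convex hx hz h.c_pos.le hc.le (by ring)
  rwa [smul_smul, mul_inv_cancel₀ hc.ne', one_smul, add_sub_cancel] at this

theorem exists_subset_closedBall (h : IsHomotheticBody K δ c) :
    ∃ D > 0, ∀ x ∈ K, K ⊆ Metric.closedBall x D ∧ K ⊆ Metric.closedBall (c • x) D := by
  obtain ⟨M, hM0, hM⟩ := h.isCompact.isBounded.subset_closedBall_lt 0 0
  refine ⟨2 * M, by linarith, fun x hx => ?_⟩
  have hx' := mem_closedBall_zero_iff.1 (hM hx)
  constructor
  · intro y hy
    have hy' := mem_closedBall_zero_iff.1 (hM hy)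
    rw [Metric.mem_closedBall, dist_eq_norm]
    linarith [norm_sub_le y x]
  · intro y hy
    have hy' := mem_closedBall_zero_iff.1 (hM hy)
    have : ‖c • x‖ ≤ ‖x‖ := by
      rw [norm_smul, Real.norm_of_nonneg h.c_pos.le]
      nlinarith [norm_nonneg x, h.c_lt_one]
    rw [Metric.mem_closedBall, dist_eq_norm]
    linarith [norm_sub_le y (c • x)]

theorem floatingBody_subset (h : IsHomotheticBody K δ c) : floatingBody K δ ⊆ K := by
  rw [h.eq_smul]
  rintro _ ⟨y, hy, rfl⟩
  have := h.convex hy (interior_subset h.zero_mem) h.c_pos.le (sub_nonneg.2 h.c_lt_one.le) (by ring)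
  simpa using this

end IsHomotheticBody

/-! ### Tilting a cap: upper bound for the second difference -/

theorem capVol_add_add_capVol_sub {n : ℕ} {K : Set (Eucl n)} (hK : IsCompact K) (x u v : Eucl n) :
    capVol K x (u + v) + capVol K x (u - v) = 2 * capVol K x u +
      (gainVol K x u v - lossVol K x u (-v)) + (gainVol K x u (-v) - lossVol K x u v) := by
  have h1 := capVol_add_lossVol hK x u v
  have h2 := capVol_add_lossVol hK x u (-v)
  rw [← sub_eq_add_neg] at h2
  linarith

/-- A shear in the direction `u` moves the wedge below the hyperplane through `x` to the wedge
above it; a contraction towards `x` of order `θ` brings the image back into `K`, because `K`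
contains a ball around `x`. -/
theorem gainVol_le_lossVol {n : ℕ} {K : Set (Eucl n)} (hK : IsCompact K) (hconv : Convex ℝ K)
    {x u w : Eucl n} (hu : ‖u‖ = 1) (hw : ‖w‖ = 1) (huw : inner ℝ u w = 0) {r D θ : ℝ} (hr : 0 < r)
    (hrK : Metric.closedBall x r ⊆ K) (hD : K ⊆ Metric.closedBall x D) (hD0 : 0 < D) (hθ : 0 < θ)
    (hθr : D / r * θ < 1) :
    (1 - D / r * θ) ^ n * gainVol K x u (θ • w) ≤ lossVol K x u (-(θ • w)) := by
  set C := D / r * θ with hC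
  have hC0 : 0 < C := by positivity
  have hdet : |LinearMap.det ((1 - C) • shear w (θ • u))| = (1 - C) ^ n := by
    rw [LinearMap.det_smul, det_shear, inner_smul_right, real_inner_comm, huw]
    simp only [mul_zero, add_zero, mul_one, finrank_euclideanSpace, Fintype.card_fin]
    exact abs_of_pos (pow_pos (by linarith) _)
  have hwu : inner ℝ w u = 0 := by rw [real_inner_comm]; exact huw
  unfold gainVol lossVol
  rw [← hdet]
  refine abs_det_mul_volume_le _ x (ne_top_of_le_ne_top hK.measure_lt_top.ne
    (measure_mono Set.inter_subset_left)) ?_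
  rintro y ⟨hyK, hy1, hy2⟩
  rw [inner_smul_left, conj_trivial] at hy2
  rw [LinearMap.smul_apply, shear_apply]
  set b := inner ℝ w (y - x) with hb
  have hbD : |b| ≤ D := by
    refine (abs_real_inner_le_norm _ _).trans ?_
    rw [hw, one_mul, ← dist_eq_norm]; exact hD hyK
  constructor
  · -- convex combination of `y` and a point of the ball around `x`
    have hz : x + ((1 - C) * r / D * b) • u ∈ K := by
      refine hrK ?_
      rw [Metric.mem_closedBall, dist_eq_norm, add_sub_cancel_left, norm_smul, hu, mul_one,
        Real.norm_eq_abs, abs_mul, abs_of_nonneg (by have := sub_pos.2 hθr; positivity)]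
      have h0 : (1 - C) * r / D * |b| ≤ (1 - C) * r / D * D := by
        have := sub_pos.2 hθr
        gcongr
      rw [div_mul_cancel₀ _ hD0.ne'] at h0
      nlinarith
    have := hconv hyK hz (sub_pos.2 hθr).le hC0.le (by ring)
    have e : C * ((1 - C) * r / D * b) = (1 - C) * (b * θ) := by
      rw [hC]; field_simp
    convert this using 1
    rw [smul_add C, smul_smul C, e]
    module
  · have h1 : inner ℝ u (x + (1 - C) • (y - x + b • θ • u) - x) =
        (1 - C) * (inner ℝ u (y - x) + θ * b) := by
      rw [add_sub_cancel_left, inner_smul_right, inner_add_right, inner_smul_right,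
        inner_smul_right, real_inner_self_eq_norm_sq, hu]
      ring
    have h2 : inner ℝ w (x + (1 - C) • (y - x + b • θ • u) - x) = (1 - C) * b := by
      rw [add_sub_cancel_left, inner_smul_right, inner_add_right, inner_smul_right,
        inner_smul_right, hwu]
      ring
    have h3 := sub_pos.2 hθr
    constructor
    · rw [h1]; exact mul_nonneg h3.le hy2
    · rw [inner_neg_left, inner_smul_left, h1, h2]
      simp only [conj_trivial]
      nlinarith

theorem gainVol_le {m : ℕ} {K : Set (Eucl (m + 2))} {x u w : Eucl (m + 2)} (hu : ‖u‖ = 1)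
    (hw : ‖w‖ = 1) {D θ : ℝ} (hD : K ⊆ Metric.closedBall x D) (hD0 : 0 < D) (hθ : 0 < θ) :
    gainVol K x u (θ • w) ≤ (2 * D) ^ (m + 1) * (D * θ) := by
  refine slab_volume_le (u := -u) (x := x) (by simpa using hu) hD0.le (by positivity)
    (fun y hy => hD hy.1) ?_
  rintro y ⟨hyK, hy1, hy2⟩
  have hbD : |inner ℝ w (y - x)| ≤ D := by
    refine (abs_real_inner_le_norm _ _).trans ?_
    rw [hw, one_mul, ← dist_eq_norm]; exact hD hyK
  rw [inner_smul_left, conj_trivial] at hy2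
  rw [inner_neg_left]
  have := le_abs_self (inner ℝ w (y - x))
  constructor <;> nlinarith

theorem capVol_second_difference_le {m : ℕ} {K : Set (Eucl (m + 2))} (hK : IsCompact K)
    (hconv : Convex ℝ K) {x u w : Eucl (m + 2)} (hu : ‖u‖ = 1) (hw : ‖w‖ = 1)
    (huw : inner ℝ u w = 0) {r D θ : ℝ} (hr : 0 < r)
    (hrK : Metric.closedBall x r ⊆ K) (hD : K ⊆ Metric.closedBall x D) (hD0 : 0 < D) (hθ : 0 < θ)
    (hθr : D / r * θ < 1) :
    capVol K x (u + θ • w) + capVol K x (u - θ • w) ≤ 2 * capVol K x u +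
      2 * ((m + 2) * (D / r) * ((2 * D) ^ (m + 1) * D)) * θ ^ 2 := by
  have key : ∀ w : Eucl (m + 2), ‖w‖ = 1 → inner ℝ u w = 0 →
      gainVol K x u (θ • w) - lossVol K x u (-(θ • w)) ≤
        (m + 2) * (D / r) * ((2 * D) ^ (m + 1) * D) * θ ^ 2 := by
    intro w hw huw
    have h1 := gainVol_le_lossVol hK hconv hu hw huw hr hrK hD hD0 hθ hθr
    have h2 := gainVol_le (K := K) (x := x) hu hw hD hD0 hθ
    have h3 : 0 ≤ gainVol K x u (θ • w) := measureReal_nonneg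
    have hC : 0 < D / r * θ := by positivity
    have h4 := one_add_mul_le_pow (a := -(D / r * θ)) (by linarith) (m + 2)
    push_cast at h4
    rw [← sub_eq_add_neg] at h4
    have h5 : (1 - (m + 2) * (D / r * θ)) * gainVol K x u (θ • w) ≤
        (1 - D / r * θ) ^ (m + 2) * gainVol K x u (θ • w) :=
      mul_le_mul_of_nonneg_right (by linarith) h3
    have h6 : (m + 2) * (D / r * θ) * gainVol K x u (θ • w) ≤
        (m + 2) * (D / r * θ) * ((2 * D) ^ (m + 1) * (D * θ)) :=
      mul_le_mul_of_nonneg_left h2 (by positivity)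
    nlinarith
  have h1 := key w hw huw
  have h2 := key (-w) (by simpa using hw) (by simpa using huw)
  rw [smul_neg, neg_neg] at h2
  rw [capVol_add_add_capVol_sub hK]
  linarith

/-! ### Uniform convexity of bodies homothetic to a floating body -/

/-- If the cap through `x` with normal `u` has volume `δ`, tilting it by an angle of order `θ` and
moving it by a distance of order `θ ^ 2` yields caps of volume at most `δ`. -/
theorem exists_inner_tilt_le {m : ℕ} {r D : ℝ} (hr : 0 < r) (hD0 : 0 < D) :
    ∃ C > 0, ∃ θ₀ > 0, ∀ (K : Set (Eucl (m + 2))) (δ : ℝ), IsCompact K → Convex ℝ K → 0 ≤ δ →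
      ∀ x ∈ floatingBody K δ, Metric.closedBall x r ⊆ K → K ⊆ Metric.closedBall x D →
        ∀ u w : Eucl (m + 2), ‖u‖ = 1 → ‖w‖ = 1 → inner ℝ u w = 0 → capVol K x u = δ →
          ∀ θ, 0 < θ → θ ≤ θ₀ → ∀ y ∈ floatingBody K δ,
            inner ℝ (u + θ • w) (y - x) ≤ C * θ ^ 2 := by
  obtain ⟨c, hc, hslab⟩ := le_slab_volume (m := m) hr
  set C₂ := 2 * ((m + 2) * (D / r) * ((2 * D) ^ (m + 1) * D)) with hC₂
  have hC₂0 : 0 < C₂ := by positivity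
  refine ⟨2 * (C₂ / c), by positivity, min 1 (min (r / (2 * D)) (r * c / C₂)), by positivity, ?_⟩
  intro K δ hK hconv hδ x hxL hrK hDK u w hu hw huw hV θ hθ hθ₀ y hy
  have hθ1 : θ ≤ 1 := hθ₀.trans (min_le_left _ _)
  have hθ2 : θ ≤ r / (2 * D) := hθ₀.trans ((min_le_right _ _).trans (min_le_left _ _))
  have hθ3 : θ ≤ r * c / C₂ := hθ₀.trans ((min_le_right _ _).trans (min_le_right _ _))
  have hθr : D / r * θ < 1 := by
    rw [le_div_iff₀ (by positivity)] at hθ2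
    rw [div_mul_eq_mul_div, div_lt_one hr]
    nlinarith
  have h1 := capVol_second_difference_le hK hconv hu hw huw hr hrK hDK hD0 hθ hθr
  have hne : ∀ w' : Eucl (m + 2), inner ℝ u w' = 0 → u + w' ≠ 0 := by
    intro w' h h0
    have : inner ℝ u (u + w') = 1 := by
      rw [inner_add_right, h, real_inner_self_eq_norm_sq, hu]; norm_num
    rw [h0, inner_zero_right] at this
    norm_num at this
  have h2 : δ ≤ capVol K x (u - θ • w) := by
    refine le_capVol_of_mem_floatingBody hK hδ ?_ hxL
    rw [sub_eq_add_neg]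
    exact hne _ (by rw [inner_neg_right, inner_smul_right, huw]; simp)
  have h3 : capVol K x (u + θ • w) ≤ δ + C₂ * θ ^ 2 := by rw [hV] at h1; linarith
  set v := u + θ • w with hv
  have hv0 : v ≠ 0 := hne _ (by rw [inner_smul_right, huw]; simp)
  have hvn : 0 < ‖v‖ := norm_pos_iff.2 hv0
  have hv2 : ‖v‖ ≤ 2 := by
    refine (norm_add_le _ _).trans ?_
    rw [norm_smul, hu, hw, Real.norm_of_nonneg hθ.le]; linarith
  have hvv : v = ‖v‖ • (‖v‖⁻¹ • v) := by
    rw [smul_smul, mul_inv_cancel₀ hvn.ne', one_smul]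
  set v' := ‖v‖⁻¹ • v with hv'
  have hv'n : ‖v'‖ = 1 := by rw [hv', norm_smul, norm_inv, norm_norm, inv_mul_cancel₀ hvn.ne']
  set s := C₂ * θ ^ 2 / c with hs
  have hs0 : 0 ≤ s := by positivity
  have hsr : s ≤ r := by
    rw [le_div_iff₀ hC₂0] at hθ3
    rw [hs, div_le_iff₀ hc]
    have := mul_le_mul_of_nonneg_left hθ1 (mul_pos hθ hC₂0).le
    nlinarith [sq θ]
  have h4 := hslab v' x hv'n K hK.measure_lt_top.ne hrK s hs0 hsr
  have hzs : inner ℝ v' (x + s • v' - x) = s := by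
    rw [add_sub_cancel_left, inner_smul_right, real_inner_self_eq_norm_sq, hv'n]; ring
  have h5 := capVol_eq_capVol_add_slab hK x (u := v') (x + s • v') (by rw [hzs]; exact hs0)
  rw [hzs] at h5
  have h6 : capVol K x v' = capVol K x v := by
    rw [hv', capVol_smul _ _ _ (inv_pos.2 hvn)]
  have h7 : c * s = C₂ * θ ^ 2 := by rw [hs]; field_simp
  have h8 := inner_le_of_mem_floatingBody hK hδ hv'n (x := x + s • v') (by linarith) hy
  have h9 : inner ℝ v' (y - x) ≤ s := by
    rw [inner_add_right, inner_smul_right, real_inner_self_eq_norm_sq, hv'n] at h8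
    rw [inner_sub_right]; linarith
  have h10 : inner ℝ v (y - x) = ‖v‖ * inner ℝ v' (y - x) := by
    conv_lhs => rw [hvv]
    rw [inner_smul_left, conj_trivial]
  rw [h10]
  have : 2 * (C₂ / c) * θ ^ 2 = 2 * s := by rw [hs]; ring
  rw [this]
  calc ‖v‖ * inner ℝ v' (y - x) ≤ ‖v‖ * s := by gcongr
    _ ≤ 2 * s := by gcongr

/-- The floating body lies in a ball of radius `R` that touches it at `x`, when the cap through `x`
with normal `u` has volume `δ`. -/
theorem exists_norm_sq_le_of_capVol_eq {m : ℕ} {r D : ℝ} (hr : 0 < r) (hD0 : 0 < D) :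
    ∃ R > 0, ∀ (K : Set (Eucl (m + 2))) (δ : ℝ), IsCompact K → Convex ℝ K → 0 ≤ δ →
      floatingBody K δ ⊆ K →
      ∀ x ∈ floatingBody K δ, Metric.closedBall x r ⊆ K → K ⊆ Metric.closedBall x D →
        ∀ u : Eucl (m + 2), ‖u‖ = 1 → capVol K x u = δ →
          ∀ y ∈ floatingBody K δ, ‖y - x‖ ^ 2 ≤ 2 * R * inner ℝ u (x - y) := by
  obtain ⟨C, hC, θ₀, hθ₀, h⟩ := exists_inner_tilt_le (m := m) hr hD0
  set C' := max C (D / (2 * θ₀)) with hC'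
  have hC'0 : 0 < C' := lt_max_of_lt_left hC
  refine ⟨(D + 4 * C') / 2, by positivity, ?_⟩
  intro K δ hK hconv hδ hLK x hx hrK hDK u hu hV y hy
  set a := inner ℝ u (y - x) with ha
  have haD : ‖y - x‖ ≤ D := by rw [← dist_eq_norm]; exact hDK (hLK hy)
  have ha0 : a ≤ 0 := by
    have := inner_le_of_mem_floatingBody hK hδ hu hV.le hy
    rw [ha, inner_sub_right]; linarith
  have haD' : -D ≤ a := by
    have := abs_real_inner_le_norm u (y - x)
    rw [hu, one_mul] at this
    linarith [(abs_le.1 (this.trans haD)).1]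
  have hxy : inner ℝ u (x - y) = -a := by rw [ha, ← inner_neg_right, neg_sub]
  rw [hxy]
  set p := y - x - a • u with hp
  have hpu : inner ℝ u p = 0 := by
    rw [hp, inner_sub_right, inner_smul_right, real_inner_self_eq_norm_sq, hu]; ring
  have hyx : y - x = a • u + p := by rw [hp]; abel
  have hnorm : ‖y - x‖ ^ 2 = a ^ 2 + ‖p‖ ^ 2 := by
    rw [hyx, norm_add_sq_real, norm_smul, hu, inner_smul_left, hpu]
    simp
  have hd : ‖p‖ ^ 2 ≤ 4 * C' * (-a) := by
    rcases (norm_nonneg p).eq_or_lt with h0 | h0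
    · rw [← h0]; nlinarith
    · have hpD : ‖p‖ ≤ D := by
        refine abs_le_of_sq_le_sq' ?_ hD0.le |>.2
        nlinarith [norm_nonneg (y - x), sq_nonneg a]
      have hwn : ‖‖p‖⁻¹ • p‖ = 1 := by
        rw [norm_smul, norm_inv, norm_norm, inv_mul_cancel₀ h0.ne']
      have hwu : inner ℝ u (‖p‖⁻¹ • p) = 0 := by rw [inner_smul_right, hpu, mul_zero]
      have hθ : ‖p‖ / (2 * C') ≤ θ₀ := by
        have h1 : D / (2 * θ₀) ≤ C' := le_max_right _ _
        rw [div_le_iff₀ (by positivity)] at h1 ⊢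
        nlinarith
      have h2 := h K δ hK hconv hδ x hx hrK hDK u _ hu hwn hwu hV _ (by positivity) hθ y hy
      have h3 : inner ℝ (‖p‖⁻¹ • p) (y - x) = ‖p‖ := by
        rw [hyx, inner_add_right, inner_smul_left, inner_smul_left, inner_smul_right,
          real_inner_comm, hpu, real_inner_self_eq_norm_sq]
        simp only [conj_trivial]
        field_simp; ring
      rw [inner_add_left, inner_smul_left, conj_trivial, h3] at h2
      have h4 : C * (‖p‖ / (2 * C')) ^ 2 ≤ C' * (‖p‖ / (2 * C')) ^ 2 := by
        gcongr; exact le_max_left _ _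
      have h5 : C' * (‖p‖ / (2 * C')) ^ 2 = ‖p‖ ^ 2 / (4 * C') := by field_simp; ring
      have h6 : ‖p‖ / (2 * C') * ‖p‖ = 2 * (‖p‖ ^ 2 / (4 * C')) := by field_simp; ring
      have h7 : ‖p‖ ^ 2 / (4 * C') ≤ -a := by linarith
      rw [div_le_iff₀ (by positivity)] at h7
      linarith
  rw [hnorm]
  nlinarith

/-- If a compact convex set is contained in a ball of radius `R` that touches it at any given
boundary point, then the same holds, with `2 R`, for *all* outer normals. Indeed, the set contains
the ball of radius `‖x - y‖ ^ 2 / (8 R)` around the midpoint of two points `x` and `y`. -/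
theorem norm_sq_le_of_forall_frontier {n : ℕ} {L : Set (Eucl n)} (hL : IsClosed L)
    (hconv : Convex ℝ L) {R : ℝ} (hR : 0 < R)
    (h : ∀ x ∈ frontier L, ∃ u, ‖u‖ = 1 ∧ ∀ y ∈ L, ‖y - x‖ ^ 2 ≤ 2 * R * inner ℝ u (x - y))
    {x u : Eucl n} (hx : x ∈ L) (hu : IsOuterUnitNormal L x u) {y : Eucl n} (hy : y ∈ L) :
    ‖y - x‖ ^ 2 ≤ 4 * R * inner ℝ u (x - y) := by
  set z := midpoint ℝ x y with hz
  have hzL : z ∈ L := hconv.midpoint_mem hx hy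
  have hzx : z - x = (2⁻¹ : ℝ) • (y - x) := midpoint_sub_left x y
  have hzy : z - y = (2⁻¹ : ℝ) • (x - y) := midpoint_sub_right x y
  have key : ∀ t, 0 ≤ t → t < ‖y - x‖ ^ 2 / (8 * R) → z + t • u ∈ L := by
    intro t ht htq
    by_contra hnot
    have hcl : IsClosed {τ : ℝ | z + τ • u ∈ L} := hL.preimage (by fun_prop)
    have hcomp : IsCompact (Set.Icc 0 t ∩ {τ : ℝ | z + τ • u ∈ L}) := isCompact_Icc.inter_right hcl
    obtain ⟨s, ⟨⟨hs0, hst⟩, hsL⟩, hmax⟩ :=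
      hcomp.exists_isGreatest ⟨0, ⟨le_rfl, ht⟩, by simpa using hzL⟩
    have hst' : s < t := lt_of_le_of_ne hst (by rintro rfl; exact hnot hsL)
    have hfr : z + s • u ∈ frontier L := by
      refine ⟨subset_closure hsL, fun hint => ?_⟩
      have hc : ContinuousAt (fun τ : ℝ => z + τ • u) s := by fun_prop
      have hev := (hc.eventually (mem_interior_iff_mem_nhds.1 hint)).filter_mono
        (nhdsWithin_le_nhds (s := Set.Ioi s))
      obtain ⟨τ, hτ, hτ'⟩ := (hev.and (Ioo_mem_nhdsGT hst')).exists
      exact absurd (hmax ⟨⟨hs0.trans hτ'.1.le, hτ'.2.le⟩, hτ⟩) (not_le.2 hτ'.1)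
    obtain ⟨v, hv, hvL⟩ := h _ hfr
    have h1 := hvL x hx
    have h2 := hvL y hy
    set b := z + s • u with hb
    have h3 : inner ℝ v (b - x) + inner ℝ v (b - y) = 2 * (s * inner ℝ v u) := by
      rw [← inner_add_right, ← inner_smul_right, ← inner_smul_right]
      congr 1
      have : b - x + (b - y) = (z - x) + (z - y) + (2 : ℝ) • s • u := by rw [hb]; module
      rw [this, hzx, hzy]
      module
    have h4 : inner ℝ v u ≤ 1 := by
      have := real_inner_le_norm v u
      rwa [hv, hu.1, one_mul] at this
    have h5 : ‖y - x‖ ^ 2 ≤ 2 * (‖x - b‖ ^ 2 + ‖y - b‖ ^ 2) := by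
      have : ‖y - x‖ ≤ ‖y - b‖ + ‖x - b‖ := by
        have e : y - x = (y - b) - (x - b) := by abel
        rw [e]; exact norm_sub_le _ _
      nlinarith [norm_nonneg (y - x), sq_nonneg (‖y - b‖ - ‖x - b‖)]
    have h6 : s * inner ℝ v u ≤ s := by nlinarith
    rw [lt_div_iff₀ (by positivity)] at htq
    nlinarith
  have hlin : ∀ t, 0 ≤ t → t < ‖y - x‖ ^ 2 / (8 * R) → t ≤ inner ℝ u (x - y) / 2 := by
    intro t ht htq
    have h1 := hu.2 _ (key t ht htq)
    have h2 : inner ℝ u (z + t • u - x) = t - inner ℝ u (x - y) / 2 := by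
      have : z + t • u - x = (2⁻¹ : ℝ) • (y - x) + t • u := by rw [← hzx]; abel
      rw [this, inner_add_right, inner_smul_right, inner_smul_right, real_inner_self_eq_norm_sq,
        hu.1, ← neg_sub x y, inner_neg_right]
      ring
    rw [inner_sub_right] at h2
    linarith
  have h0 : 0 ≤ inner ℝ u (x - y) := by
    have := hu.2 y hy
    rw [inner_sub_right]; linarith
  have : ‖y - x‖ ^ 2 / (8 * R) ≤ inner ℝ u (x - y) / 2 := by
    refine le_of_forall_lt_imp_le_of_dense fun t ht => ?_
    rcases le_or_gt 0 t with h | h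
    · exact hlin t h ht
    · linarith
  rw [div_le_iff₀ (by positivity)] at this
  linarith

theorem mem_closedBall_sub_smul_iff {n : ℕ} {x u y : Eucl n} (hu : ‖u‖ = 1) {R : ℝ}
    (hR : 0 < R) :
    y ∈ Metric.closedBall (x - R • u) R ↔ ‖y - x‖ ^ 2 ≤ 2 * R * inner ℝ u (x - y) := by
  have h : ‖y - (x - R • u)‖ ^ 2 = ‖y - x‖ ^ 2 - 2 * R * inner ℝ u (x - y) + R ^ 2 := by
    have e : y - (x - R • u) = (y - x) + R • u := by abel
    rw [e, norm_add_sq_real, inner_smul_right, norm_smul, hu, Real.norm_of_nonneg hR.le,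
      real_inner_comm, ← neg_sub x y, inner_neg_right]
    ring
  rw [Metric.mem_closedBall, dist_eq_norm, ← sq_le_sq₀ (norm_nonneg _) hR.le, h]
  constructor <;> intro <;> linarith

theorem IsHomotheticBody.exists_norm_sq_le {m : ℕ} {K : Set (Eucl (m + 2))} {δ c : ℝ}
    (h : IsHomotheticBody K δ c) :
    ∃ R > 0, ∀ x ∈ K, ∀ u, IsOuterUnitNormal K x u → ∀ y ∈ K,
      ‖y - x‖ ^ 2 ≤ 2 * R * inner ℝ u (x - y) := by
  obtain ⟨r, hr, hrK⟩ := h.exists_closedBall_subset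
  obtain ⟨D, hD, hDK⟩ := h.exists_subset_closedBall
  obtain ⟨R, hR, hRL⟩ := exists_norm_sq_le_of_capVol_eq (m := m) hr hD
  have hLcl : IsClosed (floatingBody K δ) := by
    rw [h.eq_smul]; exact h.isCompact.isClosed.smul₀ c
  have hLconv : Convex ℝ (floatingBody K δ) := by rw [h.eq_smul]; exact h.convex.smul c
  refine ⟨2 * R / c, by have := h.c_pos; positivity, fun x hx u hu y hy => ?_⟩
  have hu' : IsOuterUnitNormal (floatingBody K δ) (c • x) u := by
    refine ⟨hu.1, ?_⟩
    rw [h.eq_smul]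
    rintro _ ⟨z, hz, rfl⟩
    simp only [inner_smul_right]
    exact mul_le_mul_of_nonneg_left (hu.2 z hz) h.c_pos.le
  have := norm_sq_le_of_forall_frontier hLcl hLconv hR (fun b hb => ?_) (h.smul_mem hx) hu'
    (h.smul_mem hy)
  · rw [← smul_sub, ← smul_sub, norm_smul, inner_smul_right, Real.norm_of_nonneg h.c_pos.le] at this
    have hc := h.c_pos
    have e : 2 * (2 * R / c) * inner ℝ u (x - y) = (4 * R * inner ℝ u (x - y)) / c := by ring
    rw [e, le_div_iff₀ hc]
    refine le_of_mul_le_mul_left ?_ hc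
    linarith
  · have hbL : b ∈ floatingBody K δ := hLcl.frontier_subset hb
    obtain ⟨v, hv, hV⟩ := exists_capVol_eq_of_mem_frontier h.isCompact h.delta_pos.le hbL hb.2
    have hb' : b ∈ c • K := by rw [← h.eq_smul]; exact hbL
    obtain ⟨b', hb'K, rfl⟩ := hb'
    exact ⟨v, hv, hRL K δ h.isCompact h.convex h.delta_pos.le h.floatingBody_subset _ hbL
      (hrK b' hb'K) (hDK b' hb'K).2 v hv hV⟩

/-! ### Balls on the normal line and admissible radii -/

theorem le_normalLineInradius {n : ℕ} {K : Set (Eucl n)} (hK : IsCompact K) {x u : Eucl n}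
    (hu : ‖u‖ = 1) {r t : ℝ} (hr : 0 ≤ r) (h : Metric.closedBall (x + t • u) r ⊆ K) :
    r ≤ normalLineInradius K x u := by
  refine le_csSup ⟨Metric.diam K, ?_⟩ ⟨hr, t, h⟩
  rintro s ⟨hs, t, ht⟩
  have h1 : x + t • u + s • u ∈ K := ht (by
    rw [Metric.mem_closedBall, dist_eq_norm, add_sub_cancel_left, norm_smul, hu, mul_one,
      Real.norm_of_nonneg hs])
  have h2 : x + t • u ∈ K := ht (Metric.mem_closedBall_self hs)
  have h3 := Metric.dist_le_diam_of_mem hK.isBounded h1 h2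
  rwa [dist_eq_norm, add_sub_cancel_left, norm_smul, hu, mul_one, Real.norm_of_nonneg hs] at h3

/-- The center of a ball in `K` on the normal line at `x` lies at depth at least the radius. -/
theorem exists_closedBall_of_lt_normalLineInradius {n : ℕ} {K : Set (Eucl n)} {x u : Eucl n}
    (hx : x ∈ K) (hu : IsOuterUnitNormal K x u) {s : ℝ} (h : s < normalLineInradius K x u) :
    ∃ r > s, ∃ τ ≥ r, 0 ≤ r ∧ Metric.closedBall (x - τ • u) r ⊆ K := by
  obtain ⟨r, ⟨hr, t, ht⟩, hsr⟩ := exists_lt_of_lt_csSup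
    (s := {r : ℝ | 0 ≤ r ∧ ∃ t : ℝ, Metric.closedBall (x + t • u) r ⊆ K})
    ⟨0, le_rfl, 0, by simpa using hx⟩ h
  refine ⟨r, hsr, -t, ?_, hr, by simpa using ht⟩
  have h1 : x + t • u + r • u ∈ K := ht (by
    rw [Metric.mem_closedBall, dist_eq_norm, add_sub_cancel_left, norm_smul, hu.1, mul_one,
      Real.norm_of_nonneg hr])
  have h2 := hu.2 _ h1
  rw [inner_add_right, inner_add_right, inner_smul_right, inner_smul_right,
    real_inner_self_eq_norm_sq, hu.1] at h2
  linarith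

/-- In a body of class `C¹` the normal line at a boundary point meets the interior. -/
theorem IsClassC1.exists_mem_interior {n : ℕ} {K : Set (Eucl n)} (hC1 : IsClassC1 K)
    (hconv : Convex ℝ K) (hint : (interior K).Nonempty) {x u : Eucl n} (hx : x ∈ frontier K)
    (hu : IsOuterUnitNormal K x u) : ∃ t : ℝ, x + t • u ∈ interior K := by
  by_contra! h
  obtain ⟨v, hv, hvu, hvK⟩ := exists_unit_normal_of_line_disjoint hconv hint h
  obtain rfl : v = u := (hC1 x hx).unique ⟨hv, hvK⟩ hu
  rw [real_inner_self_eq_norm_sq, hv] at hvu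
  norm_num at hvu

theorem isCompact_normalPairs {n : ℕ} {K : Set (Eucl n)} (hK : IsCompact K) :
    IsCompact {p : Eucl n × Eucl n | p.1 ∈ frontier K ∧ IsOuterUnitNormal K p.1 p.2} := by
  have hfr : IsCompact (frontier K) := hK.of_isClosed_subset isClosed_frontier
    hK.isClosed.frontier_subset
  refine (hfr.prod (isCompact_sphere (0 : Eucl n) 1)).of_isClosed_subset ?_ ?_
  · have : {p : Eucl n × Eucl n | p.1 ∈ frontier K ∧ IsOuterUnitNormal K p.1 p.2} =
        {p | p.1 ∈ frontier K} ∩ ({p | ‖p.2‖ = 1} ∩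
          ⋂ y ∈ K, {p | inner ℝ p.2 y ≤ inner ℝ p.2 p.1}) := by
      ext p; simp [IsOuterUnitNormal]
    rw [this]
    refine (isClosed_frontier.preimage continuous_fst).inter
      ((isClosed_eq (by fun_prop) continuous_const).inter
        (isClosed_biInter fun y _ => isClosed_le (by fun_prop) (by fun_prop)))
  · rintro ⟨x, u⟩ ⟨hx, hu⟩
    exact ⟨hx, by simpa using hu.1⟩

theorem IsClassC1.exists_le_normalLineInradius {n : ℕ} {K : Set (Eucl n)} (hC1 : IsClassC1 K)
    (hK : IsCompact K) (hconv : Convex ℝ K) (hint : (interior K).Nonempty) :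
    ∃ ρ₀ > 0, ∀ x ∈ frontier K, ∀ u, IsOuterUnitNormal K x u → ρ₀ ≤ normalLineInradius K x u := by
  suffices h : ∃ ρ₀ > 0, ∀ p ∈ {p : Eucl n × Eucl n | p.1 ∈ frontier K ∧
      IsOuterUnitNormal K p.1 p.2}, ‖p.2‖ = 1 → ρ₀ ≤ normalLineInradius K p.1 p.2 by
    obtain ⟨ρ₀, hρ, h⟩ := h
    exact ⟨ρ₀, hρ, fun x hx u hu => h (x, u) ⟨hx, hu⟩ hu.1⟩
  refine (isCompact_normalPairs hK).induction_on
    (p := fun S => ∃ ρ₀ > 0, ∀ p ∈ S, ‖p.2‖ = 1 → ρ₀ ≤ normalLineInradius K p.1 p.2)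
    ⟨1, one_pos, by simp⟩ ?_ ?_ ?_
  · rintro S T hST ⟨ρ, hρ, h⟩
    exact ⟨ρ, hρ, fun p hp => h p (hST hp)⟩
  · rintro S T ⟨ρ, hρ, h⟩ ⟨ρ', hρ', h'⟩
    refine ⟨min ρ ρ', lt_min hρ hρ', ?_⟩
    rintro p (hp | hp) hp1
    · exact (min_le_left _ _).trans (h p hp hp1)
    · exact (min_le_right _ _).trans (h' p hp hp1)
  · rintro ⟨x, u⟩ ⟨hx, hu⟩
    obtain ⟨t, ht⟩ := hC1.exists_mem_interior hconv hint hx hu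
    obtain ⟨r, hr, hrK⟩ := Metric.nhds_basis_closedBall.mem_iff.1 (mem_interior_iff_mem_nhds.1 ht)
    have hc : ContinuousAt (fun p : Eucl n × Eucl n => p.1 + t • p.2) (x, u) := by fun_prop
    have hev := hc.eventually (Metric.closedBall_mem_nhds (x + t • u) (half_pos hr))
    refine ⟨_, mem_nhdsWithin_of_mem_nhds hev, r / 2, half_pos hr, fun p hp hp1 => ?_⟩
    refine le_normalLineInradius hK hp1 (half_pos hr).le (t := t)
      ((Metric.closedBall_subset_closedBall' ?_).trans hrK)
    have : dist (p.1 + t • p.2) (x + t • u) ≤ r / 2 := hp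
    linarith

theorem IsHomotheticBody.exists_admissibleRadii {m : ℕ} {K : Set (Eucl (m + 2))} {δ c : ℝ}
    (h : IsHomotheticBody K δ c) (hC1 : IsClassC1 K) : ∃ ρ₀ R, AdmissibleRadii K ρ₀ R := by
  obtain ⟨R, hR, hRK⟩ := h.exists_norm_sq_le
  obtain ⟨ρ₀, hρ₀, hρK⟩ := hC1.exists_le_normalLineInradius h.isCompact h.convex ⟨0, h.zero_mem⟩
  refine ⟨ρ₀, R, hρ₀, hR, fun x hx u hu => ⟨hρK x hx u hu, fun y hy => ?_⟩⟩
  rw [mem_closedBall_sub_smul_iff hu.1 hR]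
  exact hRK x (h.isCompact.isClosed.frontier_subset hx) u hu y hy

/-! ### Volumes of cones and the height of caps -/

/-- Cylindrical coordinates around the line `x + ℝ u` preserve the volume. -/
theorem measurePreserving_cylinder {n : ℕ} (x : Eucl n) {u : Eucl n} (hu : ‖u‖ = 1) :
    MeasurePreserving (fun p : ℝ × (Submodule.span ℝ {u})ᗮ => p.1 • u + (p.2 : Eucl n) + x)
      (volume.prod volume) volume := by
  have h1 := ((Submodule.span ℝ {u}).measurePreserving_measurableEquivProd x).symm
  rw [InnerProductSpace.euclideanHausdorffMeasure_eq_volume] at h1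
  have h2 : MeasurePreserving (LinearIsometryEquiv.toSpanUnitSingleton (𝕜 := ℝ) u hu)
    volume volume := LinearIsometryEquiv.measurePreserving _
  have h3 := h1.comp (h2.prod (MeasurePreserving.id (volume :
    Measure (Submodule.span ℝ {u})ᗮ)))
  suffices heq : (fun p : ℝ × (Submodule.span ℝ {u})ᗮ => p.1 • u + (p.2 : Eucl n) + x) =
      ((Submodule.span ℝ {u}).measurableEquivProd x).symm ∘
        Prod.map (LinearIsometryEquiv.toSpanUnitSingleton (𝕜 := ℝ) u hu) id by
    rw [heq]; exact h3
  funext p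
  simp [Submodule.measurableEquivProd_symm_apply, LinearIsometryEquiv.toSpanUnitSingleton_apply]

theorem volume_closedBall_orthogonal {m : ℕ} {u : Eucl (m + 2)} (hu : ‖u‖ = 1) {r : ℝ}
    (hr : 0 ≤ r) : volume (Metric.closedBall (0 : (Submodule.span ℝ {u})ᗮ) r) =
      ENNReal.ofReal (r ^ (m + 1)) * volume (Metric.closedBall (0 : Eucl (m + 1)) 1) := by
  have : Fact (Module.finrank ℝ (Eucl (m + 2)) = (m + 1) + 1) := ⟨by simp⟩
  have hu0 : u ≠ 0 := by rintro rfl; simp at hu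
  have hfr : Module.finrank ℝ (Submodule.span ℝ {u})ᗮ = m + 1 :=
    Submodule.finrank_orthogonal_span_singleton hu0
  have e : (Submodule.span ℝ {u})ᗮ ≃ₗᵢ[ℝ] Eucl (m + 1) :=
    ((stdOrthonormalBasis ℝ (Submodule.span ℝ {u})ᗮ).reindex (finCongr hfr)).repr
  rw [← (LinearIsometryEquiv.measurePreserving e).measure_preimage
    Metric.isClosed_closedBall.measurableSet.nullMeasurableSet,
    LinearIsometryEquiv.preimage_closedBall, map_zero, Measure.addHaar_closedBall' _ _ hr, hfr]

theorem le_volume_cone {m : ℕ} {x u : Eucl (m + 2)} (hu : ‖u‖ = 1) {k h : ℝ} (hk : 0 ≤ k)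
    (hh : 0 ≤ h) {A : Set (Eucl (m + 2))} (hfin : volume A ≠ ∞)
    (hA : ∀ a q, 0 ≤ a → a ≤ h → inner ℝ u q = 0 → ‖q‖ ≤ k * a → x - a • u + q ∈ A) :
    k ^ (m + 1) * h ^ (m + 2) / (m + 2) * volume.real (Metric.closedBall (0 : Eucl (m + 1)) 1) ≤
      volume.real A := by
  have hmp := measurePreserving_cylinder x (u := -u) (by simpa using hu)
  have hu' : ‖-u‖ = 1 := by simpa using hu
  set S : Set (ℝ × (Submodule.span ℝ {-u})ᗮ) := {p | (0 ≤ p.1 ∧ p.1 ≤ h) ∧ ‖p.2‖ ≤ k * p.1} with hS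
  have hSc : IsClosed S := by
    have : S = ({p | 0 ≤ p.1} ∩ {p | p.1 ≤ h}) ∩ {p | ‖p.2‖ ≤ k * p.1} := by
      ext p; simp [S]
    rw [this]
    exact ((isClosed_le continuous_const continuous_fst).inter
      (isClosed_le continuous_fst continuous_const)).inter
      (isClosed_le (by fun_prop) (by fun_prop))
  set F : ℝ × (Submodule.span ℝ {-u})ᗮ → Eucl (m + 2) :=
    fun p => p.1 • (-u) + (p.2 : Eucl (m + 2)) + x with hF
  have hsub : S ⊆ F ⁻¹' (toMeasurable volume A) := by
    rintro ⟨a, q⟩ ⟨⟨h1, h2⟩, h3⟩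
    refine subset_toMeasurable _ _ ?_
    have hq : inner ℝ (-u) (q : Eucl (m + 2)) = 0 :=
      Submodule.mem_orthogonal_singleton_iff_inner_right.1 q.2
    rw [inner_neg_left, neg_eq_zero] at hq
    have := hA a q h1 h2 hq h3
    convert this using 1
    simp only [F]; module
  have hvol : (volume.prod volume) S ≤ volume A := by
    refine (measure_mono hsub).trans (le_of_eq ?_)
    rw [hmp.measure_preimage (measurableSet_toMeasurable _ _).nullMeasurableSet,
      measure_toMeasurable]
  have hB : volume (Metric.closedBall (0 : Eucl (m + 1)) 1) ≠ ∞ :=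
    (isCompact_closedBall _ _).measure_lt_top.ne
  have hint : (volume.prod volume) S = ENNReal.ofReal (k ^ (m + 1) * h ^ (m + 2) / (m + 2)) *
      volume (Metric.closedBall (0 : Eucl (m + 1)) 1) := by
    rw [Measure.prod_apply hSc.measurableSet]
    have hsec : ∀ a : ℝ, volume (Prod.mk a ⁻¹' S) = (Set.Icc 0 h).indicator
        (fun a => ENNReal.ofReal ((k * a) ^ (m + 1)) *
          volume (Metric.closedBall (0 : Eucl (m + 1)) 1)) a := by
      intro a
      by_cases ha : a ∈ Set.Icc 0 h
      · rw [Set.indicator_of_mem ha, ← volume_closedBall_orthogonal hu' (mul_nonneg hk ha.1)]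
        congr 1
        ext q
        have : 0 ≤ a ∧ a ≤ h := ha
        simp [S, this]
      · rw [Set.indicator_of_notMem ha]
        have : Prod.mk a ⁻¹' S = ∅ := by
          ext q
          simp only [Set.mem_preimage, Set.mem_empty_iff_false, iff_false]
          exact fun hq => ha hq.1
        rw [this, measure_empty]
    simp_rw [hsec]
    rw [lintegral_indicator measurableSet_Icc, lintegral_mul_const' _ _ hB]
    congr 1
    rw [← ofReal_integral_eq_lintegral_ofReal]
    · congr 1
      rw [integral_Icc_eq_integral_Ioc, ← intervalIntegral.integral_of_le hh]
      simp_rw [mul_pow]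
      rw [intervalIntegral.integral_const_mul, integral_pow]
      push_cast
      simp only [ne_eq, Nat.add_eq_zero_iff, one_ne_zero, and_false, not_false_eq_true, zero_pow,
        sub_zero]
      ring
    · exact (Continuous.integrableOn_Icc (by fun_prop))
    · filter_upwards [ae_restrict_mem measurableSet_Icc] with a ha
      exact pow_nonneg (mul_nonneg hk ha.1) _
  rw [hint] at hvol
  have := ENNReal.toReal_mono hfin hvol
  rwa [ENNReal.toReal_mul, ENNReal.toReal_ofReal (by positivity)] at this

/-- The constant `δ₀` is at most the volume of a cone with apex on the boundary of `K` and height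
`R (1 - √(1 - (ρ₀ / 4R)²))`, cut off from the convex hull of the apex and a ball in `K` centered
on the normal line. This height is at most `(ρ₀ / 4)² / R`, which therefore bounds the height of
all caps of volume at most `δ₀`. -/
theorem height_le_of_capVol_le_deltaZero {m : ℕ} {K : Set (Eucl (m + 2))} (hK : IsCompact K)
    (hconv : Convex ℝ K) {ρ₀ R : ℝ} (hadm : AdmissibleRadii K ρ₀ R) {x z u : Eucl (m + 2)}
    (hx : x ∈ frontier K) (hu : IsOuterUnitNormal K x u)
    (hV : capVol K z u ≤ deltaZero (m + 2) ρ₀ R) :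
    2 * R * inner ℝ u (x - z) ≤ 2 * (ρ₀ / 4) ^ 2 := by
  obtain ⟨hρ₀, hR, hadm⟩ := hadm
  obtain ⟨hρK, hRK⟩ := hadm x hx u hu
  have hxK : x ∈ K := hK.isClosed.frontier_subset hx
  -- the radius is close enough to `ρ₀` for `r / (2 R - r)` to exceed `ρ₀ / (2 R)`
  obtain ⟨r, hr, τ, hτr, hr0', hball⟩ := exists_closedBall_of_lt_normalLineInradius hxK hu
    (s := 2 * R * ρ₀ / (2 * R + ρ₀)) (lt_of_lt_of_le (by
      rw [div_lt_iff₀ (by positivity)]; nlinarith) hρK)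
  have hr0 : 0 < r := lt_of_le_of_lt (by positivity) hr
  have hτ0 : 0 < τ := hr0.trans_le hτr
  have hτR : τ + r ≤ 2 * R := by
    have h1 : x - (τ + r) • u ∈ K := hball (by
      rw [Metric.mem_closedBall, dist_eq_norm]
      have : x - (τ + r) • u - (x - τ • u) = -(r • u) := by module
      rw [this, norm_neg, norm_smul, hu.1, mul_one, Real.norm_of_nonneg hr0.le])
    have h2 := (mem_closedBall_sub_smul_iff hu.1 hR).1 (hRK h1)
    have h3 : x - (τ + r) • u - x = -((τ + r) • u) := by module
    have h4 : x - (x - (τ + r) • u) = (τ + r) • u := by module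
    rw [h3, h4, norm_neg, norm_smul, hu.1, inner_smul_right, real_inner_self_eq_norm_sq, hu.1,
      Real.norm_of_nonneg (by positivity)] at h2
    nlinarith
  have hρr : ρ₀ * τ < r * (2 * R) := by
    rw [gt_iff_lt, div_lt_iff₀ (by positivity)] at hr
    nlinarith
  have hρR : ρ₀ ≤ 2 * R := by
    by_contra! hlt
    nlinarith
  set η := ρ₀ / (4 * R) with hη
  have hη0 : 0 < η := by positivity
  have hη1 : η ≤ 1 / 2 := by
    rw [hη, div_le_iff₀ (by positivity)]; linarith
  set g := √(1 - η ^ 2) with hg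
  have hg2 : g ^ 2 = 1 - η ^ 2 := Real.sq_sqrt (by nlinarith)
  have hg0 : 0 ≤ g := Real.sqrt_nonneg _
  have hg1 : g < 1 := by nlinarith
  -- `h₀` is the height at which the cap of a ball of radius `R` has radius `ρ₀ / 4`
  set h₀ := R * (1 - g) with hh₀
  have hh₀0 : 0 < h₀ := mul_pos hR (by linarith)
  have hηR : η * R = ρ₀ / 4 := by rw [hη]; field_simp
  have hh₀R : 2 * R * h₀ ≤ 2 * (ρ₀ / 4) ^ 2 := by
    rw [← hηR, hh₀]
    have : 1 - g ≤ η ^ 2 := by nlinarith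
    have := mul_le_mul_of_nonneg_left this (by positivity : 0 ≤ 2 * R ^ 2)
    nlinarith
  by_contra! hlt
  have hzh : h₀ < inner ℝ u (x - z) := by
    by_contra! hle
    have := mul_le_mul_of_nonneg_left hle (by positivity : 0 ≤ 2 * R)
    linarith
  have hh₀τ : h₀ ≤ τ := by
    have h1 : 1 - g ≤ η := by nlinarith
    have h2 : h₀ ≤ ρ₀ / 4 := by rw [← hηR, hh₀]; nlinarith
    have h3 : ρ₀ / 4 ≤ r := by
      rw [gt_iff_lt, div_lt_iff₀ (by positivity)] at hr
      by_contra! hr4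
      have : r * (2 * R + ρ₀) ≤ ρ₀ / 4 * (4 * R) := by gcongr; linarith
      nlinarith
    linarith
  have hcone := le_volume_cone (x := x) hu.1 (k := r / τ) (h := h₀) (by positivity) hh₀0.le
    (A := K ∩ {y | 0 ≤ inner ℝ u (y - z)})
    (ne_top_of_le_ne_top hK.measure_lt_top.ne (measure_mono Set.inter_subset_left)) ?_
  · have hd : deltaZero (m + 2) ρ₀ R = (ρ₀ / (2 * R)) ^ (m + 1) * h₀ ^ (m + 2) / (m + 2) *
        volume.real (Metric.closedBall (0 : Eucl (m + 1)) 1) := by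
      unfold deltaZero
      simp only [Nat.add_succ_sub_one]
      rw [← hη, ← hg, hh₀, mul_pow R, div_pow, mul_pow 2 R]
      push_cast
      field_simp
      ring
    have hB : 0 < volume.real (Metric.closedBall (0 : Eucl (m + 1)) 1) :=
      ENNReal.toReal_pos (Metric.measure_closedBall_pos _ _ one_pos).ne'
        (isCompact_closedBall _ _).measure_lt_top.ne
    have hk : (ρ₀ / (2 * R)) ^ (m + 1) < (r / τ) ^ (m + 1) := by
      refine pow_lt_pow_left₀ ?_ (by positivity) (by omega)
      rw [div_lt_div_iff₀ (by positivity) hτ0]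
      exact hρr
    have : deltaZero (m + 2) ρ₀ R < (r / τ) ^ (m + 1) * h₀ ^ (m + 2) / (m + 2) *
        volume.real (Metric.closedBall (0 : Eucl (m + 1)) 1) := by
      rw [hd]; gcongr
    have h5 : capVol K z u = volume.real (K ∩ {y | 0 ≤ inner ℝ u (y - z)}) := rfl
    linarith
  · intro a q ha hah hq hqa
    constructor
    · -- a convex combination of the apex and a point of the ball
      rcases ha.eq_or_lt with rfl | ha0
      · have : q = 0 := by simpa using hqa
        simpa [this] using hxK
      have hp : x - τ • u + (τ / a) • q ∈ K := hball (by
        rw [Metric.mem_closedBall, dist_eq_norm, add_sub_cancel_left, norm_smul,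
          Real.norm_of_nonneg (by positivity)]
        calc τ / a * ‖q‖ ≤ τ / a * (r / τ * a) := by gcongr
          _ = r := by field_simp)
      have haτ : a / τ ≤ 1 := by rw [div_le_one hτ0]; linarith
      have := hconv hxK hp (sub_nonneg.2 haτ) (by positivity : 0 ≤ a / τ) (by ring)
      convert this using 1
      rw [smul_add (a / τ), smul_smul (a / τ), div_mul_div_cancel₀ hτ0.ne', div_self ha0.ne',
        smul_sub (a / τ), smul_smul (a / τ), div_mul_cancel₀ _ hτ0.ne']
      module
    · have : x - a • u + q - z = (x - z) - a • u + q := by abel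
      simp only [Set.mem_ofPred_eq]
      rw [this, inner_add_right, inner_sub_right, hq, inner_smul_right,
        real_inner_self_eq_norm_sq, hu.1]
      linarith

/-! ### Tilting a cap: lower bound for the second difference -/

/-- `K` contains, below each point of the cap through `z` with normal `u`, a truncated cone of
height `s₀` around the direction `-u`. So the cap narrows strictly in the direction `u`. -/
def HasCapCones {n : ℕ} (K : Set (Eucl n)) (z u : Eucl n) (κ s₀ : ℝ) : Prop :=
  ∀ y ∈ K, 0 ≤ inner ℝ u (y - z) → ∀ e : Eucl n, ‖e‖ ≤ κ → ∀ s : ℝ, 0 ≤ s → s ≤ s₀ →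
    y + s • (e - u) ∈ K

/-- A shear in the direction `-u` moves the wedge above the hyperplane to the wedge below it. The
cones leave room for an additional expansion by the factor `1 + κ θ` in the direction `w`. -/
theorem HasCapCones.lossVol_le_gainVol {n : ℕ} {K : Set (Eucl n)} (hK : IsCompact K)
    {x u w : Eucl n} (hu : ‖u‖ = 1) (hw : ‖w‖ = 1) (huw : inner ℝ u w = 0) {κ s₀ D θ : ℝ}
    (hcone : HasCapCones K x u κ s₀) (hκ : 0 < κ) (hD : K ⊆ Metric.closedBall x D) (hθ : 0 < θ)
    (hθs : θ * D ≤ s₀) :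
    (1 + κ * θ) * lossVol K x u (-(θ • w)) ≤ gainVol K x u (θ • w) := by
  have hwu : inner ℝ w u = 0 := by rw [real_inner_comm]; exact huw
  have hdet : |LinearMap.det (shear w (θ • (κ • w - u)))| = 1 + κ * θ := by
    rw [det_shear, inner_smul_right, inner_sub_right, inner_smul_right, hwu,
      real_inner_self_eq_norm_sq, hw]
    have : 1 + θ * (κ * 1 ^ 2 - 0) = 1 + κ * θ := by ring
    rw [this, abs_of_pos (by positivity)]
  unfold gainVol lossVol
  rw [← hdet]
  refine abs_det_mul_volume_le _ x (ne_top_of_le_ne_top hK.measure_lt_top.ne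
    (measure_mono Set.inter_subset_left)) ?_
  rintro y ⟨hyK, hy1, hy2⟩
  rw [inner_neg_left, inner_smul_left, conj_trivial] at hy2
  rw [shear_apply]
  set b := inner ℝ w (y - x) with hb
  have hb0 : 0 < b := by
    by_contra! h
    nlinarith
  have hbD : b ≤ D := by
    refine (real_inner_le_norm _ _).trans ?_
    rw [hw, one_mul, ← dist_eq_norm]; exact hD hyK
  constructor
  · have := hcone y hyK hy1 (κ • w)
      (by rw [norm_smul, hw, mul_one, Real.norm_of_nonneg hκ.le]) (θ * b) (by positivity)
      (by nlinarith)
    convert this using 1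
    module
  · have h1 : inner ℝ u (x + (y - x + b • θ • (κ • w - u)) - x) = inner ℝ u (y - x) - θ * b := by
      rw [add_sub_cancel_left, inner_add_right, inner_smul_right, inner_smul_right,
        inner_sub_right _ (κ • w), inner_smul_right, huw, real_inner_self_eq_norm_sq, hu]
      ring
    have h2 : inner ℝ w (x + (y - x + b • θ • (κ • w - u)) - x) = b + b * θ * κ := by
      rw [add_sub_cancel_left, inner_add_right, inner_smul_right, inner_smul_right,
        inner_sub_right _ (κ • w), inner_smul_right, hwu, real_inner_self_eq_norm_sq, hw]
      ring
    constructor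
    · rw [h1]; linarith
    · rw [inner_smul_left, h1, h2]
      simp only [conj_trivial]
      have : 0 ≤ θ * (b * θ * κ) := by positivity
      nlinarith

theorem exists_le_capVol_second_difference {m : ℕ} {r : ℝ} (hr : 0 < r) :
    ∃ a > 0, ∀ (K : Set (Eucl (m + 2))) (x u w : Eucl (m + 2)) (κ s₀ D θ : ℝ), IsCompact K →
      Metric.closedBall x r ⊆ K → K ⊆ Metric.closedBall x D → HasCapCones K x u κ s₀ → 0 < κ →
      ‖u‖ = 1 → ‖w‖ = 1 → inner ℝ u w = 0 → 0 < θ → θ ≤ 1 → θ * D ≤ s₀ →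
      2 * capVol K x u + a * κ * θ ^ 2 ≤
        capVol K x (u + θ • w) + capVol K x (u - θ • w) := by
  obtain ⟨a, ha, hwedge⟩ := le_wedge_volume (m := m) hr
  refine ⟨2 * a, by positivity, ?_⟩
  intro K x u w κ s₀ D θ hK hrK hD hcone hκ hu hw huw hθ hθ1 hθs
  have key : ∀ w : Eucl (m + 2), ‖w‖ = 1 → inner ℝ u w = 0 →
      a * κ * θ ^ 2 ≤ gainVol K x u (θ • w) - lossVol K x u (-(θ • w)) := by
    intro w hw huw
    have h1 := hcone.lossVol_le_gainVol hK hu hw huw hκ hD hθ hθs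
    have h2 := hwedge u w x hu hw huw K hK.measure_lt_top.ne hrK θ hθ hθ1
    have h3 : lossVol K x u (-(θ • w)) = volume.real
          (K ∩ {y | 0 ≤ inner ℝ u (y - x) ∧ inner ℝ u (y - x) - θ * inner ℝ w (y - x) < 0}) := by
      simp [lossVol, inner_smul_left, sub_eq_add_neg]
    rw [← h3] at h2
    have h4 : κ * θ * (a * θ) ≤ κ * θ * lossVol K x u (-(θ • w)) :=
      mul_le_mul_of_nonneg_left h2 (by positivity)
    nlinarith
  have h1 := key w hw huw
  have h2 := key (-w) (by simpa using hw) (by simpa using huw)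
  rw [smul_neg, neg_neg] at h2
  rw [capVol_add_add_capVol_sub hK]
  linarith

theorem inner_half_add_half_sub {n : ℕ} {u₀ u₁ : Eucl n} (h : ‖u₀‖ = ‖u₁‖) :
    inner ℝ ((2⁻¹ : ℝ) • (u₀ + u₁)) ((2⁻¹ : ℝ) • (u₁ - u₀)) = 0 := by
  rw [inner_smul_left, inner_smul_right, inner_add_left, inner_sub_right, inner_sub_right,
    real_inner_self_eq_norm_sq, real_inner_self_eq_norm_sq, h, real_inner_comm]
  ring

/-! ### Low caps under admissible radii -/

/-- All directions close to the direction of `v` have cap cones, if the cap through `z` with normal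
`v` is low. The vector `v` need not be normalized; it will be a convex combination of outer unit
normals at `x`. -/
theorem AdmissibleRadii.exists_hasCapCones {n : ℕ} {K : Set (Eucl n)} (hconv : Convex ℝ K)
    {ρ₀ R : ℝ} (hadm : AdmissibleRadii K ρ₀ R) {D : ℝ} (hD0 : 0 < D)
    {x z v : Eucl n} (hx : x ∈ frontier K) (hxK : x ∈ K) (hD : K ⊆ Metric.closedBall z D)
    (hv0 : v ≠ 0) (hv1 : ‖v‖ ≤ 1) (hv : ∀ y ∈ K, ‖y - x‖ ^ 2 ≤ 2 * R * inner ℝ v (x - y))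
    (hvz : 2 * R * inner ℝ v (x - z) ≤ 2 * (ρ₀ / 4) ^ 2) :
    ∃ ε > 0, ∃ κ > 0, ∃ s₀ > 0, ∀ u, ‖u - ‖v‖⁻¹ • v‖ ≤ ε → HasCapCones K z u κ s₀ := by
  obtain ⟨hρ₀, hR, hadm⟩ := hadm
  have hvn : 0 < ‖v‖ := norm_pos_iff.2 hv0
  set u₀ := ‖v‖⁻¹ • v with hu₀
  have hvu : v = ‖v‖ • u₀ := by rw [hu₀, smul_smul, mul_inv_cancel₀ hvn.ne', one_smul]
  have hu₀n : IsOuterUnitNormal K x u₀ := by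
    refine ⟨by rw [hu₀, norm_smul, norm_inv, norm_norm, inv_mul_cancel₀ hvn.ne'], fun y hy => ?_⟩
    rw [hu₀, inner_smul_left, inner_smul_left]
    refine mul_le_mul_of_nonneg_left ?_ (by simp)
    have h1 := hv y hy
    have h2 : 0 ≤ inner ℝ v (x - y) := by
      by_contra! h
      nlinarith [sq_nonneg ‖y - x‖, mul_pos hR (neg_pos.2 h)]
    rw [inner_sub_right] at h2
    linarith
  obtain ⟨r, hr, τ, hτr, hr0, hball⟩ := exists_closedBall_of_lt_normalLineInradius hxK hu₀n
    (s := ρ₀ / 2) (by linarith [(hadm x hx u₀ hu₀n).1])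
  have hτ : 0 < τ := by linarith
  set ε := min (ρ₀ / (40 * τ)) (ρ₀ ^ 2 / (32 * R * D)) with hε
  refine ⟨ε, by positivity, ρ₀ / (40 * τ), by positivity, τ, hτ, ?_⟩
  intro u hu y hy hyz e he s hs hsτ
  have hε1 : ‖u - u₀‖ ≤ ρ₀ / (40 * τ) := hu.trans (min_le_left _ _)
  have hε2 : ‖u - u₀‖ ≤ ρ₀ ^ 2 / (32 * R * D) := hu.trans (min_le_right _ _)
  -- points of the cap are close to `x`
  have hyx : ‖y - x‖ ≤ 9 / 20 * ρ₀ := by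
    have h1 : ‖y - z‖ ≤ D := by rw [← dist_eq_norm]; exact hD hy
    have h2 : inner ℝ u₀ (z - y) ≤ ‖u - u₀‖ * D := by
      have h3 : inner ℝ u₀ (z - y) = inner ℝ (u - u₀) (y - z) - inner ℝ u (y - z) := by
        rw [inner_sub_left, ← neg_sub y z, inner_neg_right]; ring
      have h4 := real_inner_le_norm (u - u₀) (y - z)
      have h5 := mul_le_mul_of_nonneg_left h1 (norm_nonneg (u - u₀))
      linarith
    have h6 : inner ℝ v (z - y) ≤ ‖u - u₀‖ * D := by
      rw [hvu, inner_smul_left]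
      simp only [conj_trivial]
      have h7 : 0 ≤ ‖u - u₀‖ * D := by positivity
      nlinarith
    have h8 := hv y hy
    have h9 : inner ℝ v (x - y) = inner ℝ v (x - z) + inner ℝ v (z - y) := by
      rw [← inner_add_right]; congr 1; abel
    rw [le_div_iff₀ (by positivity)] at hε2
    have h10 : 2 * R * inner ℝ v (z - y) ≤ 2 * R * (‖u - u₀‖ * D) := by gcongr
    refine abs_le_of_sq_le_sq' ?_ (by positivity) |>.2
    rw [h9] at h8
    nlinarith
  have hz' : y + τ • (e - u) ∈ K := hball (by
    rw [Metric.mem_closedBall, dist_eq_norm]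
    have h1 : y + τ • (e - u) - (x - τ • u₀) = (y - x) + (τ • e - τ • (u - u₀)) := by module
    rw [h1]
    have h2 := norm_add_le (y - x) (τ • e - τ • (u - u₀))
    have h3 := norm_sub_le (τ • e) (τ • (u - u₀))
    rw [norm_smul, norm_smul, Real.norm_of_nonneg hτ.le] at h3
    rw [le_div_iff₀ (by positivity)] at he hε1
    linarith)
  have := hconv hy hz' (sub_nonneg.2 ((div_le_one hτ).2 hsτ)) (by positivity : 0 ≤ s / τ) (by ring)
  convert this using 1
  rw [smul_add (s / τ), smul_smul (s / τ), div_mul_cancel₀ _ hτ.ne']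
  module

/-! ### Balls that touch the floating body from inside -/

section touching

variable {m : ℕ} {K : Set (Eucl (m + 2))} {δ c ρ₀ R : ℝ}

theorem AdmissibleRadii.norm_sq_le (hadm : AdmissibleRadii K ρ₀ R) {x u : Eucl (m + 2)}
    (hx : x ∈ frontier K) (hu : IsOuterUnitNormal K x u) :
    ∀ y ∈ K, ‖y - x‖ ^ 2 ≤ 2 * R * inner ℝ u (x - y) := fun _ hy =>
  (mem_closedBall_sub_smul_iff hu.1 hadm.2.1).1 ((hadm.2.2 x hx u hu).2 hy)

theorem continuousAt_capVol_right (hK : IsCompact K) (x : Eucl (m + 2)) {u : Eucl (m + 2)}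
    (hu : u ≠ 0) : ContinuousAt (capVol K x) u :=
  ContinuousAt.comp (f := fun v : Eucl (m + 2) => (x, v)) (continuousAt_capVol hK x hu)
    (by fun_prop)

/-- Under admissible radii only one hyperplane through a boundary point of the floating body cuts
off the volume `δ ≤ δ₀`. Between two such directions the volume of the cap would have a local
maximum, which contradicts the lower bound for its second difference. -/
theorem IsHomotheticBody.eq_of_capVol_eq (h : IsHomotheticBody K δ c)
    (hadm : AdmissibleRadii K ρ₀ R) (hδ : δ ≤ deltaZero (m + 2) ρ₀ R) {x u₀ u₁ : Eucl (m + 2)}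
    (hx : x ∈ frontier K) (hu₀ : ‖u₀‖ = 1) (hu₁ : ‖u₁‖ = 1) (hV₀ : capVol K (c • x) u₀ = δ)
    (hV₁ : capVol K (c • x) u₁ = δ) : u₀ = u₁ := by
  by_contra hne
  have hxK : x ∈ K := h.isCompact.isClosed.frontier_subset hx
  have hN₀ := h.isOuterUnitNormal hu₀ hV₀.le
  have hN₁ := h.isOuterUnitNormal hu₁ hV₁.le
  obtain ⟨r, hr, hrK⟩ := h.exists_closedBall_subset
  obtain ⟨D, hD0, hDK⟩ := h.exists_subset_closedBall
  obtain ⟨a, ha, hsecond⟩ := exists_le_capVol_second_difference (m := m) hr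
  have hR := hadm.2.1
  have hH₀ := hadm.norm_sq_le hx hN₀
  have hH₁ := hadm.norm_sq_le hx hN₁
  have hz₀ := height_le_of_capVol_le_deltaZero h.isCompact h.convex hadm hx hN₀ (hV₀.le.trans hδ)
  have hz₁ := height_le_of_capVol_le_deltaZero h.isCompact h.convex hadm hx hN₁ (hV₁.le.trans hδ)
  -- orthogonal vectors `p`, `q` with `u₀ = p - q` and `u₁ = p + q`
  obtain ⟨p, hp⟩ : ∃ p, p = (2⁻¹ : ℝ) • (u₀ + u₁) := ⟨_, rfl⟩
  obtain ⟨q, hq⟩ : ∃ q, q = (2⁻¹ : ℝ) • (u₁ - u₀) := ⟨_, rfl⟩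
  have hpq : inner ℝ p q = 0 := by
    rw [hp, hq]; exact inner_half_add_half_sub (hu₀.trans hu₁.symm)
  have hq0 : q ≠ 0 := by
    rw [hq]
    exact smul_ne_zero (by norm_num) (sub_ne_zero.2 (Ne.symm hne))
  have hp0 : p ≠ 0 := by
    intro h0
    rw [hp, smul_eq_zero] at h0
    have h1 : u₁ = -u₀ := by
      rcases h0 with h0 | h0
      · norm_num at h0
      · exact (neg_eq_of_add_eq_zero_right h0).symm
    have hplus : c • x + r • u₀ ∈ K := hrK x hxK (by
      rw [Metric.mem_closedBall, dist_eq_norm, add_sub_cancel_left, norm_smul, hu₀, mul_one,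
        Real.norm_of_nonneg hr.le])
    have hI0 := hN₀.2 _ hplus
    have hI1 := hN₁.2 _ (hrK x hxK (Metric.mem_closedBall_self hr.le))
    rw [h1] at hI1
    simp only [inner_neg_left, inner_add_right, inner_smul_right, real_inner_self_eq_norm_sq,
      hu₀] at hI0 hI1
    linarith
  have hpn : 0 < ‖p‖ := norm_pos_iff.2 hp0
  have hqn : 0 < ‖q‖ := norm_pos_iff.2 hq0
  have hnorm : ∀ s t : ℝ, ‖s • p + t • q‖ ^ 2 = s ^ 2 * ‖p‖ ^ 2 + t ^ 2 * ‖q‖ ^ 2 := by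
    intro s t
    rw [norm_add_sq_real, inner_smul_left, inner_smul_right, hpq, norm_smul, norm_smul, mul_pow,
      mul_pow, Real.norm_eq_abs, Real.norm_eq_abs, sq_abs, sq_abs]
    ring
  have hne0 : ∀ t : ℝ, p + t • q ≠ 0 := by
    intro t h0
    have := hnorm 1 t
    rw [one_smul, h0, norm_zero] at this
    nlinarith [mul_nonneg (sq_nonneg t) (sq_nonneg ‖q‖), pow_pos hpn 2]
  have hcomb : ∀ t : ℝ, p + t • q = ((1 - t) / 2) • u₀ + ((1 + t) / 2) • u₁ := by
    intro t; rw [hp, hq]; module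
  -- an interior maximum of the volume on the arc between `u₀` and `u₁`
  obtain ⟨t, ht, htmax⟩ : ∃ t ∈ Set.Ioo (-1 : ℝ) 1, ∀ s ∈ Set.Icc (-1 : ℝ) 1,
      capVol K (c • x) (p + s • q) ≤ capVol K (c • x) (p + t • q) := by
    have hcont : Continuous fun t : ℝ => capVol K (c • x) (p + t • q) :=
      continuous_iff_continuousAt.2 fun t => ContinuousAt.comp (f := fun t : ℝ => p + t • q)
        (continuousAt_capVol_right h.isCompact _ (hne0 t)) (by fun_prop)
    obtain ⟨t, ht, hmax⟩ := (isCompact_Icc (a := (-1 : ℝ)) (b := 1)).exists_isMaxOn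
      ⟨0, by norm_num⟩ hcont.continuousOn
    replace hmax : ∀ s ∈ Set.Icc (-1 : ℝ) 1,
      capVol K (c • x) (p + s • q) ≤ capVol K (c • x) (p + t • q) := fun s hs => hmax hs
    by_cases hδt : capVol K (c • x) (p + t • q) = δ
    · refine ⟨0, by norm_num, fun s hs => (hmax s hs).trans ?_⟩
      rw [hδt]
      exact h.le_capVol hxK (hne0 0)
    · refine ⟨t, ⟨lt_of_le_of_ne ht.1 ?_, lt_of_le_of_ne ht.2 ?_⟩, hmax⟩
      · rintro rfl
        apply hδt
        rw [hcomb]; norm_num [hV₀]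
      · rintro rfl
        apply hδt
        rw [hcomb]; norm_num [hV₁]
  obtain ⟨v, hv⟩ : ∃ v, v = p + t • q := ⟨_, rfl⟩
  have hv0 : v ≠ 0 := hv ▸ hne0 t
  rw [← hv] at htmax
  have hv1 : ‖v‖ ≤ 1 := by
    rw [hv, hcomb]
    refine (norm_add_le _ _).trans ?_
    rw [norm_smul, norm_smul, hu₀, hu₁, Real.norm_of_nonneg (by linarith [ht.2]),
      Real.norm_of_nonneg (by linarith [ht.1])]
    linarith
  have hvn : 0 < ‖v‖ := norm_pos_iff.2 hv0
  have hvi : ∀ y, inner ℝ v y = (1 - t) / 2 * inner ℝ u₀ y + (1 + t) / 2 * inner ℝ u₁ y := by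
    intro y
    rw [hv, hcomb, inner_add_left, inner_smul_left, inner_smul_left]
    rfl
  have ht1 : 0 < (1 - t) / 2 := by linarith [ht.2]
  have ht2 : 0 < (1 + t) / 2 := by linarith [ht.1]
  obtain ⟨ε, hε, κ, hκ, s₀, hs₀, hcones⟩ := hadm.exists_hasCapCones h.convex hD0 hx hxK
    (hDK x hxK).2 hv0 hv1
    (fun y hy => by
      rw [hvi]
      nlinarith [mul_le_mul_of_nonneg_left (hH₀ y hy) ht1.le,
        mul_le_mul_of_nonneg_left (hH₁ y hy) ht2.le])
    (by
      rw [hvi]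
      nlinarith [mul_le_mul_of_nonneg_left hz₀ ht1.le, mul_le_mul_of_nonneg_left hz₁ ht2.le])
  set u := ‖v‖⁻¹ • v with hu
  have hun : ‖u‖ = 1 := by rw [hu, norm_smul, norm_inv, norm_norm, inv_mul_cancel₀ hvn.ne']
  have hcone := hcones u (by simpa using hε.le)
  -- the direction orthogonal to `v` in the plane of `p` and `q`
  obtain ⟨e, he⟩ : ∃ e, e = (-(t * ‖q‖ ^ 2)) • p + (‖p‖ ^ 2) • q := ⟨_, rfl⟩
  have hen : 0 < ‖e‖ := by
    rw [norm_pos_iff]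
    intro h0
    have := hnorm (-(t * ‖q‖ ^ 2)) (‖p‖ ^ 2)
    rw [← he, h0, norm_zero] at this
    have h1 : 0 < (‖p‖ ^ 2) ^ 2 * ‖q‖ ^ 2 := by positivity
    nlinarith [mul_nonneg (sq_nonneg (-(t * ‖q‖ ^ 2))) (sq_nonneg ‖p‖)]
  have hve : inner ℝ v e = 0 := by
    rw [hv, he, inner_add_left, inner_add_right, inner_add_right, inner_smul_left,
      inner_smul_right, inner_smul_right, inner_smul_left, inner_smul_right, inner_smul_right,
      hpq, real_inner_comm p q, hpq, real_inner_self_eq_norm_sq, real_inner_self_eq_norm_sq]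
    simp
    ring
  set w := ‖e‖⁻¹ • e with hw
  have hwn : ‖w‖ = 1 := by rw [hw, norm_smul, norm_inv, norm_norm, inv_mul_cancel₀ hen.ne']
  have huw : inner ℝ u w = 0 := by
    rw [hu, hw, inner_smul_left, inner_smul_right, hve]; simp
  have hle : ∀ᶠ θ : ℝ in 𝓝 0, capVol K (c • x) (u + θ • w) ≤ capVol K (c • x) u := by
    set A := ‖v‖ / ‖e‖ with hA
    have hc1 : ContinuousAt (fun θ : ℝ => 1 - θ * A * (t * ‖q‖ ^ 2)) 0 := by fun_prop
    have hc2 : ContinuousAt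
        (fun θ : ℝ => (t + θ * A * ‖p‖ ^ 2) / (1 - θ * A * (t * ‖q‖ ^ 2))) 0 :=
      ContinuousAt.div₀ (by fun_prop) hc1 (by simp)
    have h1 : ∀ᶠ θ : ℝ in 𝓝 0, 0 < 1 - θ * A * (t * ‖q‖ ^ 2) :=
      hc1.eventually (lt_mem_nhds (by simp))
    have h2 : ∀ᶠ θ : ℝ in 𝓝 0,
        (t + θ * A * ‖p‖ ^ 2) / (1 - θ * A * (t * ‖q‖ ^ 2)) ∈ Set.Ioo (-1 : ℝ) 1 :=
      hc2.eventually (Ioo_mem_nhds (by simpa using ht.1) (by simpa using ht.2))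
    filter_upwards [h1, h2] with θ h1 h2
    have h3 := htmax _ ⟨h2.1.le, h2.2.le⟩
    have h4 : u + θ • w = (‖v‖⁻¹ * (1 - θ * A * (t * ‖q‖ ^ 2))) •
        (p + ((t + θ * A * ‖p‖ ^ 2) / (1 - θ * A * (t * ‖q‖ ^ 2))) • q) := by
      have h5 : θ • w = (‖v‖⁻¹ * (θ * A)) • e := by
        rw [hw, smul_smul, hA]
        congr 1
        field_simp
      rw [h5, hu, mul_smul _ (θ * A), mul_smul _ (1 - θ * A * (t * ‖q‖ ^ 2)), ← smul_add]
      congr 1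
      rw [smul_add (1 - θ * A * (t * ‖q‖ ^ 2)), smul_smul (1 - θ * A * (t * ‖q‖ ^ 2)),
        mul_div_cancel₀ _ h1.ne', hv, he]
      module
    rw [h4, hu, capVol_smul _ _ _ (by positivity), capVol_smul _ _ _ (by positivity)]
    exact h3
  have hle' : ∀ᶠ θ : ℝ in 𝓝 0, capVol K (c • x) (u - θ • w) ≤ capVol K (c • x) u := by
    have hneg : Tendsto (fun θ : ℝ => -θ) (𝓝 0) (𝓝 0) := by
      simpa using (continuous_neg (G := ℝ)).tendsto 0
    filter_upwards [hneg.eventually hle] with θ hθ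
    rwa [neg_smul, ← sub_eq_add_neg] at hθ
  have hsmall : ∀ᶠ θ : ℝ in 𝓝 0, θ < min 1 (s₀ / D) := gt_mem_nhds (by positivity)
  obtain ⟨θ, ⟨⟨hθ1, hθ2⟩, hθ3⟩, hθ0⟩ := ((((hle.and hle').and hsmall).filter_mono
    nhdsWithin_le_nhds).and (self_mem_nhdsWithin (s := Set.Ioi (0 : ℝ)))).exists
  have hθ0' : (0 : ℝ) < θ := hθ0
  have := hsecond K (c • x) u w κ s₀ D θ h.isCompact (hrK x hxK) (hDK x hxK).2 hcone hκ hun hwn huw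
    hθ0' (hθ3.le.trans (min_le_left _ _))
    ((le_div_iff₀ hD0).1 (hθ3.le.trans (min_le_right _ _)))
  have : 0 < a * κ * θ ^ 2 := by positivity
  linarith

/-- Two unit vectors are, up to scaling, the tilts `u ± θ w` of the unit vector `u` half-way between
them. -/
theorem exists_midpoint_tilt {n : ℕ} {u₀ u₁ : Eucl n} (hu₀ : ‖u₀‖ = 1) (hu₁ : ‖u₁‖ = 1)
    (hne : u₀ ≠ u₁) (hlt : ‖u₁ - u₀‖ ≤ 1) :
    ∃ u w : Eucl n, ∃ θ a : ℝ, ‖u‖ = 1 ∧ ‖w‖ = 1 ∧ inner ℝ u w = 0 ∧ 0 < a ∧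
      ‖u₁ - u₀‖ / 2 ≤ θ ∧ θ ≤ ‖u₁ - u₀‖ ∧ ‖u - u₀‖ ≤ ‖u₁ - u₀‖ ∧
      u₀ = a • (u - θ • w) ∧ u₁ = a • (u + θ • w) := by
  obtain ⟨p, hp⟩ : ∃ p, p = (2⁻¹ : ℝ) • (u₀ + u₁) := ⟨_, rfl⟩
  obtain ⟨q, hq⟩ : ∃ q, q = (2⁻¹ : ℝ) • (u₁ - u₀) := ⟨_, rfl⟩
  have hpq : inner ℝ p q = 0 := by
    rw [hp, hq]; exact inner_half_add_half_sub (hu₀.trans hu₁.symm)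
  have hd : 0 < ‖u₁ - u₀‖ := norm_pos_iff.2 (sub_ne_zero.2 hne.symm)
  have hqn : ‖q‖ = ‖u₁ - u₀‖ / 2 := by
    rw [hq, norm_smul]; norm_num; ring
  have hpu : ‖p - u₀‖ = ‖u₁ - u₀‖ / 2 := by
    rw [← hqn]; congr 1; rw [hp, hq]; module
  have hp1 : ‖p‖ ≤ 1 := by
    rw [hp, norm_smul]
    have := norm_add_le u₀ u₁
    rw [hu₀, hu₁] at this
    norm_num
    linarith
  have hp2 : 1 - ‖u₁ - u₀‖ / 2 ≤ ‖p‖ := by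
    have := norm_sub_norm_le u₀ p
    rw [norm_sub_rev, hpu, hu₀] at this
    linarith
  have hp0 : 0 < ‖p‖ := by linarith
  have hq0 : 0 < ‖q‖ := by rw [hqn]; positivity
  refine ⟨‖p‖⁻¹ • p, ‖q‖⁻¹ • q, ‖q‖ / ‖p‖, ‖p‖,
    by rw [norm_smul, norm_inv, norm_norm, inv_mul_cancel₀ hp0.ne'],
    by rw [norm_smul, norm_inv, norm_norm, inv_mul_cancel₀ hq0.ne'],
    by rw [inner_smul_left, inner_smul_right, hpq]; simp, hp0, ?_, ?_, ?_, ?_, ?_⟩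
  · rw [le_div_iff₀ hp0, hqn]; nlinarith
  · rw [div_le_iff₀ hp0, hqn]; nlinarith
  · have h1 : ‖‖p‖⁻¹ • p - p‖ = 1 - ‖p‖ := by
      have : ‖p‖⁻¹ • p - p = (1 - ‖p‖) • (‖p‖⁻¹ • p) := by
        rw [smul_smul, sub_mul, mul_inv_cancel₀ hp0.ne', sub_smul]; simp
      rw [this, norm_smul, norm_smul, norm_inv, norm_norm, inv_mul_cancel₀ hp0.ne', mul_one,
        Real.norm_of_nonneg (by linarith)]
    have h2 := norm_add_le (‖p‖⁻¹ • p - p) (p - u₀)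
    rw [sub_add_sub_cancel, h1, hpu] at h2
    linarith
  · rw [smul_sub, smul_smul, smul_smul, smul_smul, mul_inv_cancel₀ hp0.ne',
      mul_div_cancel₀ _ hp0.ne', mul_inv_cancel₀ hq0.ne', hp, hq]
    module
  · rw [smul_add, smul_smul, smul_smul, smul_smul, mul_inv_cancel₀ hp0.ne',
      mul_div_cancel₀ _ hp0.ne', mul_inv_cancel₀ hq0.ne', hp, hq]
    module

/-- The volume of the caps through a boundary point of the floating body grows quadratically with
the distance of their normals from the one of the cap of volume `δ`. -/
theorem IsHomotheticBody.exists_le_capVol (h : IsHomotheticBody K δ c)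
    (hadm : AdmissibleRadii K ρ₀ R) (hδ : δ ≤ deltaZero (m + 2) ρ₀ R) {x u₀ : Eucl (m + 2)}
    (hx : x ∈ frontier K) (hu₀ : ‖u₀‖ = 1) (hV₀ : capVol K (c • x) u₀ = δ) :
    ∃ b > 0, ∀ u, ‖u‖ = 1 → δ + b * ‖u - u₀‖ ^ 2 ≤ capVol K (c • x) u := by
  have hxK : x ∈ K := h.isCompact.isClosed.frontier_subset hx
  have hN₀ := h.isOuterUnitNormal hu₀ hV₀.le
  obtain ⟨r, hr, hrK⟩ := h.exists_closedBall_subset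
  obtain ⟨D, hD0, hDK⟩ := h.exists_subset_closedBall
  obtain ⟨a, ha, hsecond⟩ := exists_le_capVol_second_difference (m := m) hr
  have hne0 : ∀ u : Eucl (m + 2), ‖u‖ = 1 → u ≠ 0 := fun u hu => by rintro rfl; simp at hu
  obtain ⟨ε, hε, κ, hκ, s₀, hs₀, hcones⟩ := hadm.exists_hasCapCones h.convex hD0 hx hxK
    (hDK x hxK).2 (hne0 u₀ hu₀) hu₀.le (hadm.norm_sq_le hx hN₀)
    (height_le_of_capVol_le_deltaZero h.isCompact h.convex hadm hx hN₀ (hV₀.le.trans hδ))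
  rw [hu₀, inv_one, one_smul] at hcones
  set η := min ε (min 1 (s₀ / D)) with hη
  have hη0 : 0 < η := by positivity
  -- near `u₀`, by the second difference at the direction half-way between `u₀` and `u`
  have hnear : ∀ u, ‖u‖ = 1 → ‖u - u₀‖ < η →
      δ + a * κ / 4 * ‖u - u₀‖ ^ 2 ≤ capVol K (c • x) u := by
    intro u hu hlt
    by_cases hne : u₀ = u
    · rw [← hne, sub_self, norm_zero, hV₀]; simp
    have h1 : ‖u - u₀‖ ≤ 1 := hlt.le.trans ((min_le_right _ _).trans (min_le_left _ _))
    have h2 : ‖u - u₀‖ ≤ s₀ / D := hlt.le.trans ((min_le_right _ _).trans (min_le_right _ _))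
    obtain ⟨v, w, θ, α, hv, hw, hvw, hα, hθ, hθ', hvu, hu₀v, huv⟩ :=
      exists_midpoint_tilt hu₀ hu hne h1
    have hθ0 : 0 < θ := lt_of_lt_of_le (half_pos (norm_pos_iff.2 (sub_ne_zero.2 (Ne.symm hne)))) hθ
    rw [le_div_iff₀ hD0] at h2
    have h3 := hsecond K (c • x) v w κ s₀ D θ h.isCompact (hrK x hxK) (hDK x hxK).2
      (hcones v (hvu.trans (hlt.le.trans (min_le_left _ _)))) hκ hv hw hvw hθ0 (hθ'.trans h1)
      ((mul_le_mul_of_nonneg_right hθ' hD0.le).trans h2)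
    have h4 : capVol K (c • x) (v + θ • w) = capVol K (c • x) u := by
      rw [huv, capVol_smul _ _ _ hα]
    have h5 : capVol K (c • x) (v - θ • w) = δ := by
      rw [← hV₀, hu₀v, capVol_smul _ _ _ hα]
    have h6 := h.le_capVol hxK (hne0 v hv)
    have h7 : (‖u - u₀‖ / 2) ^ 2 ≤ θ ^ 2 := by gcongr
    have h8 := mul_le_mul_of_nonneg_left h7 (mul_pos ha hκ).le
    rw [h4, h5] at h3
    nlinarith
  -- away from `u₀`, by compactness and uniqueness
  obtain ⟨b, hb, hfar⟩ : ∃ b > 0, ∀ u, ‖u‖ = 1 → η ≤ ‖u - u₀‖ → δ + b ≤ capVol K (c • x) u := by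
    have hcomp : IsCompact (Metric.sphere (0 : Eucl (m + 2)) 1 ∩ {u | η ≤ ‖u - u₀‖}) :=
      (isCompact_sphere _ _).inter_right (isClosed_le continuous_const (by fun_prop))
    rcases (Metric.sphere (0 : Eucl (m + 2)) 1 ∩
      {u | η ≤ ‖u - u₀‖}).eq_empty_or_nonempty with h0 | h0
    · refine ⟨1, one_pos, fun u hu hu' => ?_⟩
      have : u ∈ Metric.sphere (0 : Eucl (m + 2)) 1 ∩ {u | η ≤ ‖u - u₀‖} := ⟨by simpa using hu, hu'⟩
      rw [h0] at this
      exact this.elim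
    · obtain ⟨v, ⟨hv1, hv2⟩, hmin⟩ := hcomp.exists_isMinOn h0
        (f := capVol K (c • x)) fun u hu => (continuousAt_capVol_right h.isCompact _
          (hne0 u (by simpa using hu.1))).continuousWithinAt
      have hvn : ‖v‖ = 1 := by simpa using hv1
      have hlt : δ < capVol K (c • x) v := by
        refine lt_of_le_of_ne (h.le_capVol hxK (hne0 v hvn)) fun heq => ?_
        have := h.eq_of_capVol_eq hadm hδ hx hu₀ hvn hV₀ heq.symm
        have hv2' : η ≤ ‖v - u₀‖ := hv2
        rw [← this, sub_self, norm_zero] at hv2'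
        linarith
      refine ⟨capVol K (c • x) v - δ, sub_pos.2 hlt, fun u hu hu' => ?_⟩
      rw [add_sub_cancel]
      exact hmin ⟨by simpa using hu, hu'⟩
  refine ⟨min (a * κ / 4) (b / 4), by positivity, fun u hu => ?_⟩
  rcases lt_or_ge ‖u - u₀‖ η with hlt | hge
  · refine le_trans ?_ (hnear u hu hlt)
    gcongr
    exact min_le_left _ _
  · refine le_trans ?_ (hfar u hu hge)
    have h1 : ‖u - u₀‖ ≤ 2 := by
      have := norm_sub_le u u₀
      rw [hu, hu₀] at this; linarith
    have h2 : min (a * κ / 4) (b / 4) * ‖u - u₀‖ ^ 2 ≤ b / 4 * 2 ^ 2 := by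
      gcongr
      exact min_le_right _ _
    linarith

/-- A ball in the floating body touches its boundary at the given point. -/
theorem IsHomotheticBody.exists_closedBall_subset_floatingBody (h : IsHomotheticBody K δ c)
    (hadm : AdmissibleRadii K ρ₀ R) (hδ : δ ≤ deltaZero (m + 2) ρ₀ R) {x : Eucl (m + 2)}
    (hx : x ∈ frontier K) :
    ∃ u₀, ‖u₀‖ = 1 ∧ ∃ r > 0, Metric.closedBall (c • x - r • u₀) r ⊆ floatingBody K δ := by
  have hxK : x ∈ K := h.isCompact.isClosed.frontier_subset hx
  obtain ⟨u₀, hu₀, hV₀⟩ := h.exists_capVol_eq hx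
  obtain ⟨b, hb, hquad⟩ := h.exists_le_capVol hadm hδ hx hu₀ hV₀
  obtain ⟨D, hD0, hDK⟩ := h.exists_subset_closedBall
  set C := (2 * D) ^ (m + 1) with hC
  have hC0 : 0 < C := by positivity
  refine ⟨u₀, hu₀, b / C, by positivity, fun y hy => ?_⟩
  by_contra hyL
  obtain ⟨u, hu, hVy, hsep⟩ :=
    exists_capVol_le_of_notMem_floatingBody h.isCompact h.delta_pos.le hyL
  have hz := hsep _ (h.smul_mem hxK)
  set z := c • x with hzdef
  set r := b / C with hr
  have hr0 : 0 < r := by positivity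
  have hs0 : 0 < inner ℝ u (y - z) := by rw [inner_sub_right]; linarith
  have h1 := capVol_eq_capVol_add_slab h.isCompact z (u := u) y hs0.le
  have h2 : volume.real (K ∩ {v | 0 ≤ inner ℝ u (v - z) ∧ inner ℝ u (v - z) < inner ℝ u (y - z)}) ≤
      C * inner ℝ u (y - z) :=
    slab_volume_le hu hD0.le hs0.le (fun v hv => (hDK x hxK).2 hv.1)
      fun v hv => ⟨hv.2.1, hv.2.2.le⟩
  have h3 := hquad u hu
  have h4 := (mem_closedBall_sub_smul_iff hu₀ hr0).1 hy
  -- the height of `y` above `z` in the direction `u` is at most `r / 2 * ‖u - u₀‖ ^ 2`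
  have h5 : inner ℝ u (y - z) = inner ℝ (u - u₀) (y - z) - inner ℝ u₀ (z - y) := by
    rw [inner_sub_left, ← neg_sub y z, inner_neg_right]; ring
  have h6 := real_inner_le_norm (u - u₀) (y - z)
  have h7 : 2 * r * inner ℝ u (y - z) ≤ r ^ 2 * ‖u - u₀‖ ^ 2 := by
    rw [h5]
    nlinarith [sq_nonneg (r * ‖u - u₀‖ - ‖y - z‖)]
  have h8 : b * ‖u - u₀‖ ^ 2 ≤ C * inner ℝ u (y - z) := by linarith
  have hbr : b = C * r := by rw [hr]; field_simp
  rw [hbr] at h8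
  have h9 : r * ‖u - u₀‖ ^ 2 ≤ inner ℝ u (y - z) := by
    refine le_of_mul_le_mul_left ?_ hC0
    linarith
  nlinarith [mul_pos hr0 hs0]

end touching

/-! ### Smoothness of bodies homothetic to floating bodies for small `δ` -/

theorem exists_mem_frontier_closedBall_subset {n : ℕ} {K : Set (Eucl n)} (hK : IsCompact K)
    (hne : (Kᶜ).Nonempty) (h0 : (0 : Eucl n) ∈ interior K) :
    ∃ p ∈ frontier K, 0 < ‖p‖ ∧ Metric.closedBall 0 ‖p‖ ⊆ K := by
  obtain ⟨p, hp, hdist⟩ := isClosed_closure.exists_infDist_eq_dist hne.closure (0 : Eucl n)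
  have hp0 : p ≠ 0 := by
    rintro rfl
    rw [closure_compl] at hp
    exact hp h0
  have hball : Metric.ball (0 : Eucl n) ‖p‖ ⊆ K := by
    intro y hy
    by_contra hyK
    have h1 := Metric.infDist_le_dist_of_mem (x := (0 : Eucl n))
      (subset_closure hyK : y ∈ closure Kᶜ)
    rw [hdist, dist_zero_left, dist_zero_left] at h1
    rw [mem_ball_zero_iff] at hy
    linarith
  have hcl : Metric.closedBall (0 : Eucl n) ‖p‖ ⊆ K := by
    rw [← closure_ball _ (norm_ne_zero_iff.2 hp0)]
    exact closure_minimal hball hK.isClosed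
  refine ⟨p, ?_, norm_pos_iff.2 hp0, hcl⟩
  rw [frontier_eq_closure_inter_closure]
  exact ⟨subset_closure (hcl (by simp)), hp⟩

/-- A ball in `K` that touches the boundary forces `δ ≥ a (1 - c) ^ ((n + 1) / 2)`.
The inequality is squared to avoid half-integral exponents. -/
theorem exists_le_delta_sq {m : ℕ} {K : Set (Eucl (m + 2))} (hK : IsCompact K)
    (h0 : (0 : Eucl (m + 2)) ∈ interior K) :
    ∃ a > 0, ∀ δ c, IsHomotheticBody K δ c → a * (1 - c) ^ (m + 3) ≤ δ ^ 2 := by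
  have hne : (Kᶜ).Nonempty := by
    rw [Set.nonempty_compl]
    rintro rfl
    exact noncompact_univ _ hK
  obtain ⟨p, hp, hρ, hball⟩ := exists_mem_frontier_closedBall_subset hK hne h0
  set ρ := ‖p‖ with hρdef
  refine ⟨ρ ^ 2 / 4 * (2 * ρ ^ 2 / (m + 1)) ^ (m + 1), by positivity, fun δ c h => ?_⟩
  obtain ⟨u, hu, hV⟩ := h.exists_capVol_eq hp
  have hN := h.isOuterUnitNormal hu hV.le
  -- the normal at `p` is the direction of `p`
  have hpu : p = ρ • u := by
    have h1 := hN.2 (ρ • u) (hball (by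
      rw [mem_closedBall_zero_iff, norm_smul, hu, mul_one, Real.norm_of_nonneg hρ.le]))
    rw [inner_smul_right, real_inner_self_eq_norm_sq, hu] at h1
    have h2 : ‖p - ρ • u‖ ^ 2 ≤ 0 := by
      rw [norm_sub_sq_real, inner_smul_right, norm_smul, hu, Real.norm_of_nonneg hρ.le,
        real_inner_comm, ← hρdef]
      nlinarith
    have h3 : ‖p - ρ • u‖ = 0 := by
      have := sq_nonneg ‖p - ρ • u‖
      exact pow_eq_zero_iff two_ne_zero |>.1 (le_antisymm h2 this)
    exact sub_eq_zero.1 (norm_eq_zero.1 h3)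
  have hc0 : 0 < 1 - c := sub_pos.2 h.c_lt_one
  set H := (1 - c) * ρ with hH
  have hH0 : 0 < H := mul_pos hc0 hρ
  have hHρ : H ≤ ρ := by rw [hH]; nlinarith [h.c_pos]
  obtain ⟨w, hw, huw⟩ := exists_unit_orthogonal hu
  set q := √(ρ * H / (2 * (m + 1))) with hq
  have hq0 : 0 ≤ q := Real.sqrt_nonneg _
  have hq2 : q ^ 2 = ρ * H / (2 * (m + 1)) := Real.sq_sqrt (by positivity)
  have hq2' : (m + 1) * q ^ 2 = ρ * H / 2 := by rw [hq2]; field_simp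
  have hle := le_volume_of_frame (x := p) (α := -H) (β := -(H / 2)) (γ := -q) (ε := q) (q := q)
    hu hw huw (by linarith) (by linarith) hq0 (A := K ∩ {y | 0 ≤ inner ℝ u (y - c • p)})
    (ne_top_of_le_ne_top hK.measure_lt_top.ne (measure_mono Set.inter_subset_left)) ?_
  · have hVδ : volume.real (K ∩ {y | 0 ≤ inner ℝ u (y - c • p)}) = δ := hV
    rw [hVδ] at hle
    have hle' : H / 2 * (2 * q) ^ (m + 1) ≤ δ := by
      refine le_trans (le_of_eq ?_) hle
      ring
    calc ρ ^ 2 / 4 * (2 * ρ ^ 2 / (m + 1)) ^ (m + 1) * (1 - c) ^ (m + 3)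
        = (H / 2) ^ 2 * (4 * q ^ 2) ^ (m + 1) := by
          have e : 4 * q ^ 2 = 2 * ρ ^ 2 / (m + 1) * (1 - c) := by
            rw [hq2, hH]; field_simp; ring
          rw [e, mul_pow _ (1 - c), hH]
          ring
      _ = (H / 2 * (2 * q) ^ (m + 1)) ^ 2 := by
          rw [mul_pow (H / 2), ← pow_mul, mul_comm (m + 1) 2, pow_mul]
          ring
      _ ≤ δ ^ 2 := by gcongr
  · rintro y ⟨hy1, hy2⟩ ⟨hy3, hy4⟩ hy5
    constructor
    · refine hball ?_
      rw [mem_closedBall_zero_iff]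
      refine abs_le_of_sq_le_sq' ?_ hρ.le |>.2
      have h3 : inner ℝ w (y - p) ^ 2 ≤ q ^ 2 := sq_le_sq' hy3 hy4
      have h4 : ‖y‖ ^ 2 = ‖y - p‖ ^ 2 + 2 * ρ * inner ℝ u (y - p) + ρ ^ 2 := by
        have : y = (y - p) + ρ • u := by rw [← hpu]; abel
        conv_lhs => rw [this, norm_add_sq_real, inner_smul_right, norm_smul, hu,
          Real.norm_of_nonneg hρ.le, real_inner_comm]
        ring
      have h5 : inner ℝ u (y - p) ^ 2 ≤ H * (-inner ℝ u (y - p)) := by nlinarith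
      rw [h4]
      nlinarith
    · have : y - c • p = (y - p) + H • u := by
        rw [hH, mul_smul, ← hpu]; module
      simp only [Set.mem_ofPred_eq]
      rw [this, inner_add_right, inner_smul_right, real_inner_self_eq_norm_sq, hu]
      linarith

/-- A boundary point with two outer unit normals forces `δ ≤ a (1 - c) ^ ((n + 2) / 2)`, because
near this point `K` lies in a wedge.
The inequality is squared to avoid half-integral exponents. -/
theorem exists_delta_sq_le {m : ℕ} {K : Set (Eucl (m + 2))} {R : ℝ} (hR : 0 < R)
    {x u₁ u₂ : Eucl (m + 2)} (hx : x ∈ K) (hxK : ∃ y ∈ K, y ≠ x)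
    (hR₁ : ∀ y ∈ K, ‖y - x‖ ^ 2 ≤ 2 * R * inner ℝ u₁ (x - y))
    (hR₂ : ∀ y ∈ K, ‖y - x‖ ^ 2 ≤ 2 * R * inner ℝ u₂ (x - y)) (hu₁ : ‖u₁‖ = 1) (hu₂ : ‖u₂‖ = 1)
    (hne : u₁ ≠ u₂) :
    ∃ a > 0, ∀ δ c, IsHomotheticBody K δ c → δ ^ 2 ≤ a * (1 - c) ^ (m + 4) := by
  obtain ⟨p, hp⟩ : ∃ p, p = (2⁻¹ : ℝ) • (u₁ + u₂) := ⟨_, rfl⟩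
  obtain ⟨q, hq⟩ : ∃ q, q = (2⁻¹ : ℝ) • (u₂ - u₁) := ⟨_, rfl⟩
  have hpq : inner ℝ p q = 0 := by
    rw [hp, hq]; exact inner_half_add_half_sub (hu₁.trans hu₂.symm)
  have hu₁pq : u₁ = p - q := by rw [hp, hq]; module
  have hu₂pq : u₂ = p + q := by rw [hp, hq]; module
  have hRp : ∀ y ∈ K, ‖y - x‖ ^ 2 ≤ 2 * R * inner ℝ p (x - y) := by
    intro y hy
    have h1 := hR₁ y hy
    have h2 := hR₂ y hy
    rw [hu₁pq, inner_sub_left] at h1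
    rw [hu₂pq, inner_add_left] at h2
    linarith
  have hq0 : 0 < ‖q‖ := by
    rw [norm_pos_iff, hq]
    exact smul_ne_zero (by norm_num) (sub_ne_zero.2 (Ne.symm hne))
  have hp0 : 0 < ‖p‖ := by
    rw [norm_pos_iff]
    rintro rfl
    obtain ⟨y, hy, hyx⟩ := hxK
    have h1 := hRp y hy
    have h2 : 0 < ‖y - x‖ := norm_pos_iff.2 (sub_ne_zero.2 hyx)
    rw [inner_zero_left, mul_zero] at h1
    nlinarith
  have hp1 : ‖p‖ ≤ 1 := by
    rw [hp, norm_smul]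
    have := norm_add_le u₁ u₂
    rw [hu₁, hu₂] at this
    norm_num
    linarith
  set u := ‖p‖⁻¹ • p with hu
  set w := ‖q‖⁻¹ • q with hw
  have hun : ‖u‖ = 1 := by rw [hu, norm_smul, norm_inv, norm_norm, inv_mul_cancel₀ hp0.ne']
  have hwn : ‖w‖ = 1 := by rw [hw, norm_smul, norm_inv, norm_norm, inv_mul_cancel₀ hq0.ne']
  have huw : inner ℝ u w = 0 := by
    rw [hu, hw, inner_smul_left, inner_smul_right, hpq]; simp
  have hpu : p = ‖p‖ • u := by rw [hu, smul_smul, mul_inv_cancel₀ hp0.ne', one_smul]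
  have hqw : q = ‖q‖ • w := by rw [hw, smul_smul, mul_inv_cancel₀ hq0.ne', one_smul]
  clear_value u w
  refine ⟨(2 / ‖q‖) ^ 2 * (8 * R) ^ m * (‖x‖ + 1) ^ (m + 4), by positivity, fun δ c h => ?_⟩
  have hc0 : 0 < 1 - c := sub_pos.2 h.c_lt_one
  set H := (1 - c) * (‖x‖ + 1) with hH
  have hH0 : 0 < H := by positivity
  have hu0 : u ≠ 0 := by rintro rfl; simp at hun
  have hδV := h.le_capVol hx hu0
  have hle : capVol K (c • x) u ≤ (0 - -H) * (H / ‖q‖ - -(H / ‖q‖)) * (2 * √(2 * R * H)) ^ m := by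
    refine volume_le_of_frame (x := x) hun hwn huw (by linarith)
      (by have : 0 < H / ‖q‖ := by positivity
          linarith) (Real.sqrt_nonneg _) ?_
    rintro y ⟨hyK, hy⟩
    simp only [Set.mem_ofPred_eq] at hy
    have ha1 : -H ≤ inner ℝ u (y - x) := by
      have h1 : inner ℝ u (y - c • x) = inner ℝ u (y - x) + (1 - c) * inner ℝ u x := by
        rw [← inner_smul_right, ← inner_add_right]; congr 1; module
      have h2 := real_inner_le_norm u x
      rw [hun, one_mul] at h2
      have h3 : (1 - c) * inner ℝ u x ≤ (1 - c) * (‖x‖ + 1) := by gcongr; linarith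
      linarith
    have hpa : inner ℝ p (x - y) = ‖p‖ * -inner ℝ u (y - x) := by
      conv_lhs => rw [hpu, inner_smul_left, ← neg_sub y x, inner_neg_right]
      rfl
    have h1 := hRp y hyK
    rw [hpa] at h1
    have ha0 : 0 ≤ -inner ℝ u (y - x) := by
      by_contra! hlt
      have : 2 * R * (‖p‖ * -inner ℝ u (y - x)) < 0 :=
        mul_neg_of_pos_of_neg (by positivity) (mul_neg_of_pos_of_neg hp0 hlt)
      linarith [sq_nonneg ‖y - x‖]
    have hpH : ‖p‖ * -inner ℝ u (y - x) ≤ H := by nlinarith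
    refine ⟨⟨ha1, by linarith⟩, ?_, ?_⟩
    · have hqb : inner ℝ q (x - y) = -(‖q‖ * inner ℝ w (y - x)) := by
        conv_lhs => rw [hqw, inner_smul_left, ← neg_sub y x, inner_neg_right]
        simp
      have h2 := hR₁ y hyK
      have h3 := hR₂ y hyK
      rw [hu₁pq, inner_sub_left, hpa, hqb] at h2
      rw [hu₂pq, inner_add_left, hpa, hqb] at h3
      have h4 : 0 ≤ ‖p‖ * -inner ℝ u (y - x) - -(‖q‖ * inner ℝ w (y - x)) := by
        by_contra! hlt
        nlinarith [sq_nonneg ‖y - x‖, mul_pos hR (neg_pos.2 hlt)]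
      have h5 : 0 ≤ ‖p‖ * -inner ℝ u (y - x) + -(‖q‖ * inner ℝ w (y - x)) := by
        by_contra! hlt
        nlinarith [sq_nonneg ‖y - x‖, mul_pos hR (neg_pos.2 hlt)]
      constructor
      · rw [neg_le, ← sub_nonneg, ← mul_nonneg_iff_of_pos_left hq0]
        have : ‖q‖ * (H / ‖q‖ - -inner ℝ w (y - x)) = H + ‖q‖ * inner ℝ w (y - x) := by
          field_simp; ring
        linarith
      · rw [le_div_iff₀ hq0]
        linarith
    · refine Real.le_sqrt_of_sq_le (h1.trans ?_)
      gcongr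
  have hs : √(2 * R * H) ^ 2 = 2 * R * H := Real.sq_sqrt (by positivity)
  calc δ ^ 2 ≤ (2 / ‖q‖ * H ^ 2 * (2 * √(2 * R * H)) ^ m) ^ 2 := by
        have hδ := h.delta_pos
        gcongr
        refine hδV.trans (hle.trans (le_of_eq ?_))
        ring
    _ = (2 / ‖q‖) ^ 2 * H ^ 4 * (4 * √(2 * R * H) ^ 2) ^ m := by
        rw [mul_pow (2 / ‖q‖ * H ^ 2), ← pow_mul, mul_comm m 2, pow_mul]
        ring
    _ = (2 / ‖q‖) ^ 2 * (8 * R) ^ m * (‖x‖ + 1) ^ (m + 4) * (1 - c) ^ (m + 4) := by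
        rw [hs]
        have e : 4 * (2 * R * H) = 8 * R * H := by ring
        have e' : H ^ (m + 4) = (‖x‖ + 1) ^ (m + 4) * (1 - c) ^ (m + 4) := by
          rw [hH, mul_pow, mul_comm]
        rw [e, mul_pow (8 * R) H, mul_assoc _ ((‖x‖ + 1) ^ (m + 4)), ← e']
        ring

/-- If `K` is not of class `C¹`, it can be homothetic to `K_δ` only for large `δ`. -/
theorem exists_lt_delta_of_not_isClassC1 {m : ℕ} {K : Set (Eucl (m + 2))} (hC1 : ¬ IsClassC1 K) :
    ∃ δ₁ > 0, ∀ δ c, IsHomotheticBody K δ c → δ₁ < δ := by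
  by_cases hex : ∃ δ c, IsHomotheticBody K δ c
  swap
  · push Not at hex
    exact ⟨1, one_pos, fun δ c h => (hex δ c h).elim⟩
  obtain ⟨δ₀, c₀, h₀⟩ := hex
  obtain ⟨R, hR, hRK⟩ := h₀.exists_norm_sq_le
  have hK := h₀.isCompact
  unfold IsClassC1 at hC1
  push Not at hC1
  obtain ⟨x, hx, hnu⟩ := hC1
  have hxK : x ∈ K := hK.isClosed.frontier_subset hx
  obtain ⟨u₁, hu₁, -, hu₁K⟩ := exists_unit_normal_of_line_disjoint h₀.convex ⟨0, h₀.zero_mem⟩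
    (x := x) (u := 0) (by simpa using hx.2)
  have hN₁ : IsOuterUnitNormal K x u₁ := ⟨hu₁, hu₁K⟩
  obtain ⟨u₂, hN₂, hne⟩ : ∃ u₂, IsOuterUnitNormal K x u₂ ∧ u₁ ≠ u₂ := by
    by_contra! hall
    exact hnu ⟨u₁, hN₁, fun u hu => (hall u hu).symm⟩
  have hx0 : (0 : Eucl (m + 2)) ≠ x := by
    rintro rfl
    exact hx.2 h₀.zero_mem
  obtain ⟨a, ha, hupper⟩ := exists_delta_sq_le hR hxK ⟨0, interior_subset h₀.zero_mem, hx0⟩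
    (hRK x hxK u₁ hN₁) (hRK x hxK u₂ hN₂) hu₁ hN₂.1 hne
  obtain ⟨b, hb, hlower⟩ := exists_le_delta_sq hK h₀.zero_mem
  refine ⟨√(b * (b / a) ^ (m + 3)) / 2, by positivity, fun δ c h => ?_⟩
  have hc0 : 0 < 1 - c := sub_pos.2 h.c_lt_one
  have h1 := hupper δ c h
  have h2 := hlower δ c h
  have h3 : b / a ≤ 1 - c := by
    rw [div_le_iff₀ ha]
    refine le_of_mul_le_mul_right ?_ (pow_pos hc0 (m + 3))
    refine (h2.trans h1).trans (le_of_eq (by ring))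
  have h4 : √(b * (b / a) ^ (m + 3)) ≤ δ := by
    refine Real.sqrt_le_iff.2 ⟨h.delta_pos.le, le_trans ?_ h2⟩
    gcongr
  have h5 : 0 < √(b * (b / a) ^ (m + 3)) := by positivity
  linarith

/-! ### Principal curvatures -/

theorem HasPrincipalCurvatures.tendsto {n : ℕ} {K : Set (Eucl n)} {x u : Eucl n}
    {e : Fin (n - 1) → Eucl n} {k : Fin (n - 1) → ℝ≥0∞} (h : HasPrincipalCurvatures K x u e k)
    (i : Fin (n - 1)) :
    Tendsto (fun s : ℝ => 2 * boundaryHeight K x u (s • e i) / ENNReal.ofReal (s ^ 2))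
      (𝓝[>] 0) (𝓝 (k i)) := by
  obtain ⟨-, he, hue, hlim⟩ := h
  convert hlim (e i) (hue i) using 2
  rw [Finset.sum_eq_single i]
  · rw [real_inner_self_eq_norm_sq, he.1]; simp
  · intro j _ hj
    rw [he.2 hj]; simp
  · simp

theorem two_mul_ofReal_div_ofReal {a s : ℝ} (hs : 0 < s) :
    2 * ENNReal.ofReal (s ^ 2 * a) / ENNReal.ofReal (s ^ 2) = 2 * ENNReal.ofReal a := by
  have h1 : ENNReal.ofReal (s ^ 2) ≠ 0 := by simpa using hs.ne'
  rw [ENNReal.ofReal_mul (by positivity), mul_left_comm, mul_comm,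
    mul_div_assoc, ENNReal.div_self h1 ENNReal.ofReal_ne_top, mul_one]

/-- A ball that contains `K` and touches it at `x` bounds the principal curvatures from below. -/
theorem HasPrincipalCurvatures.ne_zero {n : ℕ} {K : Set (Eucl n)} {x u : Eucl n}
    {e : Fin (n - 1) → Eucl n} {k : Fin (n - 1) → ℝ≥0∞} (h : HasPrincipalCurvatures K x u e k)
    {R : ℝ} (hR : 0 < R) (hRK : ∀ y ∈ K, ‖y - x‖ ^ 2 ≤ 2 * R * inner ℝ u (x - y))
    (i : Fin (n - 1)) : k i ≠ 0 := by
  have hbound : 2 * ENNReal.ofReal (1 / (2 * R)) ≤ k i := by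
    refine ge_of_tendsto (h.tendsto i) ?_
    filter_upwards [self_mem_nhdsWithin] with s hs
    have hs0 : (0 : ℝ) < s := hs
    rw [← two_mul_ofReal_div_ofReal hs0]
    gcongr
    refine le_iInf₂ fun t ht => ENNReal.ofReal_le_ofReal ?_
    have h1 := hRK _ ht.2
    have h2 : x + s • e i - t • u - x = s • e i - t • u := by abel
    have h3 : x - (x + s • e i - t • u) = t • u - s • e i := by abel
    rw [h2, h3, norm_sub_sq_real, norm_smul, norm_smul, h.2.1.1, h.1.1, inner_sub_right,
      inner_smul_right, inner_smul_right, inner_smul_left, inner_smul_right, h.2.2.1 i,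
      real_inner_comm u (e i), h.2.2.1 i, real_inner_self_eq_norm_sq, h.1.1,
      Real.norm_of_nonneg hs0.le, Real.norm_of_nonneg ht.1] at h1
    simp only [mul_one, mul_zero, sub_zero, one_pow] at h1
    rw [mul_one_div, div_le_iff₀ (by positivity)]
    nlinarith [sq_nonneg t]
  intro h0
  rw [h0, nonpos_iff_eq_zero, mul_eq_zero, ENNReal.ofReal_eq_zero] at hbound
  rcases hbound with h1 | h1
  · norm_num at h1
  · have : 0 < 1 / (2 * R) := by positivity
    linarith

/-- A ball in `K` that touches the boundary at `x` bounds the principal curvatures from above. -/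
theorem HasPrincipalCurvatures.ne_top {n : ℕ} {K : Set (Eucl n)} {x u : Eucl n}
    {e : Fin (n - 1) → Eucl n} {k : Fin (n - 1) → ℝ≥0∞} (h : HasPrincipalCurvatures K x u e k)
    {r : ℝ} (hr : 0 < r) (hrK : Metric.closedBall (x - r • u) r ⊆ K) (i : Fin (n - 1)) :
    k i ≠ ∞ := by
  have hbound : k i ≤ 2 * ENNReal.ofReal (1 / r) := by
    refine le_of_tendsto (h.tendsto i) ?_
    filter_upwards [Ioo_mem_nhdsGT hr] with s hs
    have hs0 : (0 : ℝ) < s := hs.1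
    rw [← two_mul_ofReal_div_ofReal hs0]
    gcongr
    refine iInf₂_le_of_le (s ^ 2 * (1 / r)) ⟨by positivity, hrK ?_⟩ le_rfl
    rw [mem_closedBall_sub_smul_iff h.1.1 hr]
    set t := s ^ 2 * (1 / r) with ht
    have ht0 : 0 ≤ t := by positivity
    have htr : t * r = s ^ 2 := by rw [ht]; field_simp
    have h2 : x + s • e i - t • u - x = s • e i - t • u := by abel
    have h3 : x - (x + s • e i - t • u) = t • u - s • e i := by abel
    rw [h2, h3, norm_sub_sq_real, norm_smul, norm_smul, h.2.1.1, h.1.1, inner_sub_right,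
      inner_smul_right, inner_smul_right, inner_smul_left, inner_smul_right, h.2.2.1 i,
      real_inner_comm u (e i), h.2.2.1 i, real_inner_self_eq_norm_sq, h.1.1,
      Real.norm_of_nonneg hs0.le, Real.norm_of_nonneg ht0]
    have hts : t ≤ s := by
      refine le_of_mul_le_mul_right ?_ hr
      nlinarith [hs.2]
    nlinarith
  exact ne_top_of_le_ne_top (ENNReal.mul_ne_top ENNReal.ofNat_ne_top ENNReal.ofReal_ne_top) hbound

theorem deltaZero_pos {m : ℕ} {ρ₀ R : ℝ} (hρ₀ : 0 < ρ₀) (hR : 0 < R) :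
    0 < deltaZero (m + 2) ρ₀ R := by
  have h1 : 0 < volume.real (Metric.closedBall (0 : Eucl (m + 2 - 1)) 1) :=
    ENNReal.toReal_pos (Metric.measure_closedBall_pos _ _ one_pos).ne'
      (isCompact_closedBall _ _).measure_lt_top.ne
  have h2 : √(1 - (ρ₀ / (4 * R)) ^ 2) < 1 := by
    rw [Real.sqrt_lt' one_pos]
    have : 0 < (ρ₀ / (4 * R)) ^ 2 := by positivity
    linarith
  have h3 : 0 < 1 - √(1 - (ρ₀ / (4 * R)) ^ 2) := by linarith
  unfold deltaZero
  positivity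

/-- Under admissible radii, a body homothetic to `K_δ` with `δ ≤ δ₀` has a touching ball inside and
outside at each boundary point, so that all principal curvatures are positive and finite. -/
theorem IsHomotheticBody.not_hasGaussCurvature {m : ℕ} {K : Set (Eucl (m + 2))} {δ c ρ₀ R : ℝ}
    (h : IsHomotheticBody K δ c) (hadm : AdmissibleRadii K ρ₀ R)
    (hδ : δ ≤ deltaZero (m + 2) ρ₀ R) {x : Eucl (m + 2)} (hx : x ∈ frontier K) :
    ¬ (HasGaussCurvature K x 0 ∨ HasGaussCurvature K x ∞) := by
  have key : ∀ κ, HasGaussCurvature K x κ → κ ≠ 0 ∧ κ ≠ ∞ := by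
    rintro κ ⟨u, e, k, hk, -, rfl⟩
    obtain ⟨u₀, hu₀, r, hr, hball⟩ := h.exists_closedBall_subset_floatingBody hadm hδ hx
    have hc := h.c_pos
    have hball' : Metric.closedBall (x - (r / c) • u₀) (r / c) ⊆ K := by
      intro y hy
      have hcy : c • y ∈ c • K := by
        rw [← h.eq_smul]
        refine hball ?_
        have e1 : c • x - r • u₀ = c • (x - (r / c) • u₀) := by
          rw [smul_sub, smul_smul, mul_div_cancel₀ _ hc.ne']
        rw [Metric.mem_closedBall, dist_eq_norm, e1, ← smul_sub, norm_smul,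
          Real.norm_of_nonneg hc.le, ← dist_eq_norm]
        calc c * dist y (x - (r / c) • u₀) ≤ c * (r / c) := by
              gcongr; exact hy
          _ = r := mul_div_cancel₀ _ hc.ne'
      exact (Set.smul_mem_smul_set_iff₀ hc.ne' _ _).1 hcy
    have hrc : 0 < r / c := by positivity
    -- the normal of a ball that touches the boundary from inside is the only outer normal
    have huu : u = u₀ := by
      have h1 := hk.1.2 (x - (r / c) • u₀ + (r / c) • u) (hball' (by
        rw [Metric.mem_closedBall, dist_eq_norm, add_sub_cancel_left, norm_smul, hk.1.1, mul_one,
          Real.norm_of_nonneg hrc.le]))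
      rw [inner_add_right, inner_sub_right, inner_smul_right, inner_smul_right,
        real_inner_self_eq_norm_sq, hk.1.1] at h1
      refine (inner_eq_one_iff_of_norm_eq_one (𝕜 := ℝ) hk.1.1 hu₀).1 (le_antisymm ?_ ?_)
      · have := real_inner_le_norm u u₀
        rwa [hk.1.1, hu₀, one_mul] at this
      · refine le_of_mul_le_mul_left ?_ hrc
        linarith
    rw [← huu] at hball'
    exact ⟨Finset.prod_ne_zero_iff.2 fun i _ => hk.ne_zero hadm.2.1 (hadm.norm_sq_le hx hk.1) i,
      ENNReal.prod_ne_top fun i _ => hk.ne_top hrc hball' i⟩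
  rintro (h0 | h0)
  · exact (key 0 h0).1 rfl
  · exact (key ∞ h0).2 rfl

theorem mainTheorem4 (n : ℕ) (hn : 2 ≤ n) (K : ConvexBody (Eucl n))
    (hK : (interior (K : Set (Eucl n))).Nonempty)
    (hcurv : ∃ x ∈ frontier (K : Set (Eucl n)),
      HasGaussCurvature (K : Set (Eucl n)) x 0 ∨ HasGaussCurvature (K : Set (Eucl n)) x ∞) :
    (∃ δ₁ : ℝ, 0 < δ₁ ∧ ∀ δ : ℝ, 0 < δ → δ ≤ δ₁ →
      ¬ HomotheticAtZero (K : Set (Eucl n)) (floatingBody (K : Set (Eucl n)) δ)) ∧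
    (∀ ρ₀ R : ℝ, AdmissibleRadii (K : Set (Eucl n)) ρ₀ R →
      ∀ δ : ℝ, 0 < δ → δ ≤ deltaZero n ρ₀ R →
        ¬ HomotheticAtZero (K : Set (Eucl n)) (floatingBody (K : Set (Eucl n)) δ)) ∧
    (IsClassC1 (K : Set (Eucl n)) → ∀ δ : ℝ, 0 < δ →
      HomotheticAtZero (K : Set (Eucl n)) (floatingBody (K : Set (Eucl n)) δ) →
        ∃ ρ₀ R : ℝ, AdmissibleRadii (K : Set (Eucl n)) ρ₀ R) := by
  obtain ⟨m, rfl⟩ : ∃ m, n = m + 2 := ⟨n - 2, by omega⟩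
  obtain ⟨x, hx, hκ⟩ := hcurv
  have hbody : ∀ δ : ℝ, 0 < δ → HomotheticAtZero (K : Set (Eucl (m + 2))) (floatingBody K δ) →
      ∃ c, IsHomotheticBody (K : Set (Eucl (m + 2))) δ c := fun δ hδ h =>
    exists_isHomotheticBody K.isCompact K.convex hK hδ h
  have h2 : ∀ ρ₀ R : ℝ, AdmissibleRadii (K : Set (Eucl (m + 2))) ρ₀ R →
      ∀ δ : ℝ, 0 < δ → δ ≤ deltaZero (m + 2) ρ₀ R →
        ¬ HomotheticAtZero (K : Set (Eucl (m + 2))) (floatingBody K δ) := by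
    intro ρ₀ R hadm δ hδ hδ₀ h
    obtain ⟨c, hc⟩ := hbody δ hδ h
    exact hc.not_hasGaussCurvature hadm hδ₀ hx hκ
  have h3 : IsClassC1 (K : Set (Eucl (m + 2))) → ∀ δ : ℝ, 0 < δ →
      HomotheticAtZero (K : Set (Eucl (m + 2))) (floatingBody K δ) →
        ∃ ρ₀ R : ℝ, AdmissibleRadii (K : Set (Eucl (m + 2))) ρ₀ R := by
    intro hC1 δ hδ h
    obtain ⟨c, hc⟩ := hbody δ hδ h
    exact hc.exists_admissibleRadii hC1
  refine ⟨?_, h2, h3⟩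
  by_cases hC1 : IsClassC1 (K : Set (Eucl (m + 2)))
  · by_cases hex : ∃ ρ₀ R : ℝ, AdmissibleRadii (K : Set (Eucl (m + 2))) ρ₀ R
    · obtain ⟨ρ₀, R, hadm⟩ := hex
      exact ⟨deltaZero (m + 2) ρ₀ R, deltaZero_pos hadm.1 hadm.2.1, h2 ρ₀ R hadm⟩
    · exact ⟨1, one_pos, fun δ hδ _ h => hex (h3 hC1 δ hδ h)⟩
  · obtain ⟨δ₁, hδ₁, hlt⟩ := exists_lt_delta_of_not_isClassC1 hC1
    refine ⟨δ₁, hδ₁, fun δ hδ hle h => ?_⟩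
    obtain ⟨c, hc⟩ := hbody δ hδ h
    exact absurd (hlt δ c hc) (not_lt.2 hle)
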